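/- **Proposition 3.1.** Let $X$ be a compact complex manifold with $\dim_{\mathbb C}X=n$. For integers $p,q$ let $C^\infty_{p,q}(X,\mathbb C)$ be the space of smooth complex-valued forms of bidegree $(p,q)$ (zero unless $0\le p,q\le n$), and let $d=\partial+\bar\partial$. Let $$E_1^{p,q}(X)=\frac{\ker(\bar\partial:C^\infty_{p,q}(X,\mathbb C)\to C^\infty_{p,q+1}(X,\mathbb C))}{\mathrm{Im}(\bar\partial:C^\infty_{p,q-1}(X,\mathbb C)\to C^\infty_{p,q}(X,\mathbb C))},\qquad d_1^{p,q}:E_1^{p,q}(X)\to E_1^{p+1,q}(X),\quad d_1([\alpha]_{\bar\partial})=[\partial\alpha]_{\bar\partial},$$ be the first page of the Frölicher spectral sequence of $X$, and let $E_2^{p,q}(X)=\ker d_1^{p,q}/\mathrm{Im}\,d_1^{p-1,q}$ be its second page, which consists of the double classes $\big[[\alpha]_{\bar\partial}\big]_{d_1}$ of the forms $\alpha\in C^\infty_{p,q}(X,\mathbb C)$ such that $\bar\partial\alpha=0$ and $\partial\alpha\in\mathrm{Im}\,\bar\partial$. Let $$d_2^{p,q}:E_2^{p,q}(X)\to E_2^{p+2,q-1}(X),\qquad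 d_2\Big(\big[[\alpha]_{\bar\partial}\big]_{d_1}\Big)=\big[[\partial u]_{\bar\partial}\big]_{d_1},$$ where $u\in C^\infty_{p+1,q-1}(X,\mathbb C)$ is any form with $\partial\alpha=\bar\partial u$. Then the linear map $$T:H^{2n-2}_{DR}(X,\mathbb C)\longrightarrow E_2^{n-2,n}(X),\qquad \{\alpha\}_{DR}\longmapsto\Big[[\alpha^{n-2,n}]_{\bar\partial}\Big]_{d_1},$$ where $\alpha^{n-2,n}$ is the component of bidegree $(n-2,n)$ of the $d$-closed $(2n-2)$-form $\alpha$, is well defined: $\alpha^{n-2,n}$ defines a class in $E_2^{n-2,n}(X)$, and this class depends only on the de Rham class of $\alpha$. Its image is $$\mathrm{Im}\,T=\ker\big(d_2^{n-2,n}:E_2^{n-2,n}(X)\to E_2^{n,n-1}(X)\big).$$ -/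

import Mathlib

open scoped Manifold ContDiff Topology

/-- The space `ℂⁿ`, on which `n`-dimensional complex manifolds are modelled. -/
abbrev ComplexSpace (n : ℕ) : Type := EuclideanSpace ℂ (Fin n)

namespace ComplexManifold

noncomputable section

/-! Throughout, `X` is a complex manifold: a space with charts in the complex vector space `E`
whose transition maps are holomorphic (`IsManifold 𝓘(ℂ, E) ω X`). -/

variable (E : Type*) [NormedAddCommGroup E] [NormedSpace ℂ E]
  (X : Type*) [TopologicalSpace X] [ChartedSpace E X]

/-- Complex-valued `k`-forms at the point `x`: alternating real-multilinear maps in `k` tangent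
vectors at `x`, with values in `ℂ`. -/
abbrev FormAt (k : ℕ) (x : X) : Type _ := TangentSpace 𝓘(ℂ, E) x [⋀^Fin k]→L[ℝ] ℂ

variable {E X} in
/-- The expression of a `k`-form in the chart at `c`, that is, its pullback under the inverse of
this chart. -/
def chartRep {k : ℕ} (α : ∀ x : X, FormAt E X k x) (c : X) (y : E) : E [⋀^Fin k]→L[ℝ] ℂ :=
  (α ((chartAt E c).symm y)).compContinuousLinearMap
    ((mfderiv 𝓘(ℂ, E) 𝓘(ℂ, E) (chartAt E c).symm y).restrictScalars ℝ)

/-- The space of smooth complex-valued `k`-forms on `X`: their expressions in the charts are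
`C^∞` in the real sense. -/
def smoothForms (k : ℕ) : Submodule ℂ (∀ x : X, FormAt E X k x) where
  carrier := {α | ∀ c : X, ContDiffOn ℝ ∞ (chartRep α c) (chartAt E c).target}
  add_mem' := by
    intro a b ha hb c
    exact (ha c).add (hb c)
  zero_mem' := by
    intro c
    exact contDiffOn_const (c := (0 : E [⋀^Fin k]→L[ℝ] ℂ))
  smul_mem' := by
    intro z a ha c
    exact (ha c).const_smul z

/-- The smooth complex-valued `k`-forms on `X`, as a type. -/
def SmoothForm (k : ℕ) : Type _ := smoothForms E X k

instance (k : ℕ) : AddCommGroup (SmoothForm E X k) :=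
  inferInstanceAs (AddCommGroup (smoothForms E X k))

instance (k : ℕ) : Module ℂ (SmoothForm E X k) :=
  inferInstanceAs (Module ℂ (smoothForms E X k))

variable {E X} in
/-- Evaluation of a form at a point on tangent vectors. -/
def SmoothForm.eval {k : ℕ} (x : X) (v : Fin k → TangentSpace 𝓘(ℂ, E) x) : SmoothForm E X k →ₗ[ℂ] ℂ where
  toFun α := α.1 x v
  map_add' _ _ := rfl
  map_smul' _ _ := rfl

variable {E X} in
lemma SmoothForm.ext {k : ℕ} {α β : SmoothForm E X k}
    (h : ∀ (x : X) (v : Fin k → TangentSpace 𝓘(ℂ, E) x), α.1 x v = β.1 x v) : α = β :=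
  Subtype.ext (funext fun x => ContinuousAlternatingMap.ext (h x))

variable {E X} in
/-- The exterior derivative at `x`, computed in the chart at `x`. (The result does not depend on
the chart, see `chartRep_extDerivAt`.) -/
def extDerivAt {k : ℕ} (α : ∀ x : X, FormAt E X k x) (x : X) : FormAt E X (k+1) x :=
  (extDeriv (chartRep α x) (chartAt E x x)).compContinuousLinearMap
    ((mfderiv 𝓘(ℂ, E) 𝓘(ℂ, E) (chartAt E x) x).restrictScalars ℝ)

variable {E X}

lemma minSmoothness_two_le : minSmoothness ℝ 2 ≤ ∞ := by
  simp only [minSmoothness_of_isRCLikeNormedField]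
  exact WithTop.coe_le_coe.2 le_top

lemma mfderiv_symm_eq [IsManifold 𝓘(ℂ, E) ω X] (c c' : X) {y : E}
    (hy' : (chartAt E c).symm y ∈ (chartAt E c').source) (v : E) :
    (mfderiv 𝓘(ℂ, E) 𝓘(ℂ, E) (chartAt E c).symm y v : E) =
    (mfderiv 𝓘(ℂ, E) 𝓘(ℂ, E) (chartAt E c').symm (chartAt E c' ((chartAt E c).symm y))
     (mfderiv 𝓘(ℂ, E) 𝓘(ℂ, E) (chartAt E c') ((chartAt E c).symm y)
      (mfderiv 𝓘(ℂ, E) 𝓘(ℂ, E) (chartAt E c).symm y v)) : E) := by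
  have : IsManifold 𝓘(ℂ, E) 1 X := IsManifold.of_le (n := ω) le_top
  set x := (chartAt E c).symm y with hx
  have := (mdifferentiable_chart (I := 𝓘(ℂ, E)) c').symm_comp_deriv hy'
  have h2 := congrArg (fun f => f (mfderiv 𝓘(ℂ, E) 𝓘(ℂ, E) (chartAt E c).symm y v)) this
  exact h2.symm

lemma fderiv_transition [IsManifold 𝓘(ℂ, E) ω X] (c c' : X) {y : E} (hy : y ∈ (chartAt E c).target)
    (hy' : (chartAt E c).symm y ∈ (chartAt E c').source) (v : E) :
    fderiv ℝ (chartAt E c' ∘ (chartAt E c).symm) y v =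
     (mfderiv 𝓘(ℂ, E) 𝓘(ℂ, E) (chartAt E c') ((chartAt E c).symm y)
      (mfderiv 𝓘(ℂ, E) 𝓘(ℂ, E) (chartAt E c).symm y v) : E) := by
  have : IsManifold 𝓘(ℂ, E) 1 X := IsManifold.of_le (n := ω) le_top
  have h1 := (mdifferentiable_chart (I := 𝓘(ℂ, E)) c).mdifferentiableAt_symm hy
  have h2 := (mdifferentiable_chart (I := 𝓘(ℂ, E)) c').mdifferentiableAt hy'
  have h3 := mfderiv_comp (x := y) h2 h1
  have h4 := (h2.comp y h1).differentiableAt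
  rw [mfderiv_eq_fderiv] at h3
  rw [h4.fderiv_restrictScalars ℝ]
  exact congrArg (fun f => f v) h3

lemma contDiffAt_transition [IsManifold 𝓘(ℂ, E) ω X] (c c' : X) {y : E}
    (hy : y ∈ (chartAt E c).target)
    (hy' : (chartAt E c).symm y ∈ (chartAt E c').source) :
    ContDiffAt ℝ ∞ (chartAt E c' ∘ (chartAt E c).symm) y := by
  have h := contDiffOn_ext_coord_change (n := ω) (I := 𝓘(ℂ, E)) c' c
  have hs : ((chartAt E c).symm.trans (chartAt E c')).source ∈ 𝓝 y :=
    ((chartAt E c).symm.trans (chartAt E c')).open_source.mem_nhds (by simp [hy, hy'])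
  have h1 : ContDiffAt ℂ ω (chartAt E c' ∘ (chartAt E c).symm) y := by
    refine ContDiffOn.contDiffAt (h.congr_mono (fun _ _ => by simp) ?_) hs
    intro z hz
    simpa using hz
  exact (h1.restrict_scalars ℝ).of_le le_top

lemma chartRep_transition [IsManifold 𝓘(ℂ, E) ω X] {k : ℕ} (α : ∀ x : X, FormAt E X k x)
    (c c' : X) {y : E} (hy : y ∈ (chartAt E c).target)
    (hy' : (chartAt E c).symm y ∈ (chartAt E c').source) :
    chartRep α c y = (chartRep α c' ((chartAt E c' ∘ (chartAt E c).symm) y)).compContinuousLinearMap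
      (fderiv ℝ (chartAt E c' ∘ (chartAt E c).symm) y) := by
  ext v
  let β : X → E [⋀^Fin k]→L[ℝ] ℂ := α
  have hx : (chartAt E c').symm (chartAt E c' ((chartAt E c).symm y)) = (chartAt E c).symm y :=
    (chartAt E c').left_inv hy'
  change β ((chartAt E c).symm y)
      (fun i => (mfderiv 𝓘(ℂ, E) 𝓘(ℂ, E) (chartAt E c).symm y (v i) : E)) =
    β ((chartAt E c').symm (chartAt E c' ((chartAt E c).symm y)))
      (fun i => (mfderiv 𝓘(ℂ, E) 𝓘(ℂ, E) (chartAt E c').symm (chartAt E c' ((chartAt E c).symm y))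
        (fderiv ℝ (chartAt E c' ∘ (chartAt E c).symm) y (v i)) : E))
  rw [hx]
  congr 1
  funext i
  rw [mfderiv_symm_eq c c' hy', fderiv_transition c c' hy hy']
  rfl

lemma chartRep_extDerivAt [IsManifold 𝓘(ℂ, E) ω X] {k : ℕ} {α : ∀ x : X, FormAt E X k x}
    (hα : α ∈ smoothForms E X k) (c : X) {y : E} (hy : y ∈ (chartAt E c).target) :
    chartRep (extDerivAt α) c y = extDeriv (chartRep α c) y := by
  set x := (chartAt E c).symm y with hx
  have hxs : x ∈ (chartAt E x).source := mem_chart_source E x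
  have hev : chartRep α c =ᶠ[𝓝 y] fun y' =>
      (chartRep α x ((chartAt E x ∘ (chartAt E c).symm) y')).compContinuousLinearMap
      (fderiv ℝ (chartAt E x ∘ (chartAt E c).symm) y') := by
    have : ((chartAt E c).symm.trans (chartAt E x)).source ∈ 𝓝 y :=
      ((chartAt E c).symm.trans (chartAt E x)).open_source.mem_nhds (by simp [hy, ← hx, hxs])
    filter_upwards [this] with y' hy'
    simp at hy'
    exact chartRep_transition α c x hy'.1 hy'.2
  rw [hev.extDeriv_eq, extDeriv_pullback (r := ∞) _ (contDiffAt_transition c x hy hxs) minSmoothness_two_le]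
  · ext v
    change extDeriv (chartRep α x) (chartAt E x x) (fun i =>
       (mfderiv 𝓘(ℂ, E) 𝓘(ℂ, E) (chartAt E x) x
      (mfderiv 𝓘(ℂ, E) 𝓘(ℂ, E) (chartAt E c).symm y (v i)) : E)) =
      extDeriv (chartRep α x) (chartAt E x x) (fun i => 
        fderiv ℝ (chartAt E x ∘ (chartAt E c).symm) y (v i))
    congr 1
    funext i
    rw [fderiv_transition c x hy hxs]
  · exact ((hα x).contDiffAt ((chartAt E x).open_target.mem_nhds 
      (mem_chart_target E x))).differentiableAt (by simp)

lemma contDiffOn_extDeriv {k : ℕ} {f : E → E [⋀^Fin k]→L[ℝ] ℂ} {s : Set E} (hs : IsOpen s)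
    (hf : ContDiffOn ℝ ∞ f s) : ContDiffOn ℝ ∞ (extDeriv f) s := by
  have h1 : ContDiffOn ℝ ∞ (fderiv ℝ f) s := hf.fderiv_of_isOpen hs (by simp)
  exact (ContinuousAlternatingMap.alternatizeUncurryFinCLM ℝ E ℂ (n := k)).contDiff.comp_contDiffOn h1

lemma extDerivAt_mem [IsManifold 𝓘(ℂ, E) ω X] {k : ℕ} {α : ∀ x : X, FormAt E X k x}
    (hα : α ∈ smoothForms E X k) : extDerivAt α ∈ smoothForms E X (k + 1) := fun c =>
  (contDiffOn_extDeriv (chartAt E c).open_target (hα c)).congr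
    fun _ hy => chartRep_extDerivAt hα c hy

lemma differentiableAt_chartRep {k : ℕ} {α : ∀ x : X, FormAt E X k x}
    (hα : α ∈ smoothForms E X k) (x : X) : DifferentiableAt ℝ (chartRep α x) (chartAt E x x) :=
  ((hα x).contDiffAt ((chartAt E x).open_target.mem_nhds 
      (mem_chart_target E x))).differentiableAt (by simp)

variable (E X) in
/-- The exterior derivative on smooth complex-valued `k`-forms. -/
def extD [IsManifold 𝓘(ℂ, E) ω X] (k : ℕ) : SmoothForm E X k →ₗ[ℂ] SmoothForm E X (k + 1) where
  toFun α := ⟨extDerivAt α.1, extDerivAt_mem α.2⟩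
  map_add' a b := by
    refine Subtype.ext (funext fun x => ?_)
    change (extDeriv (chartRep a.1 x + chartRep b.1 x) _).compContinuousLinearMap _ = _
    rw [extDeriv_add (differentiableAt_chartRep a.2 x) (differentiableAt_chartRep b.2 x)]
    rfl
  map_smul' z a := by
    refine Subtype.ext (funext fun x => ?_)
    change (ContinuousAlternatingMap.alternatizeUncurryFin (fderiv ℝ (z • chartRep a.1 x) _)).compContinuousLinearMap _ = _
    rw [fderiv_const_smul (differentiableAt_chartRep a.2 x)]
    ext v
    change ContinuousAlternatingMap.alternatizeUncurryFin (z • fderiv ℝ (chartRep a.1 x) _) _ =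
      z * ContinuousAlternatingMap.alternatizeUncurryFin (fderiv ℝ (chartRep a.1 x) _) _
    simp [ContinuousAlternatingMap.alternatizeUncurryFin_apply, Finset.mul_sum]

lemma extD_extD [IsManifold 𝓘(ℂ, E) ω X] (k : ℕ) (α : SmoothForm E X k) :
    extD E X (k + 1) (extD E X k α) = 0 := by
  refine Subtype.ext (funext fun x => ?_)
  change (extDeriv (chartRep (extDerivAt α.1) x) (chartAt E x x)).compContinuousLinearMap _ = _
  have : chartRep (extDerivAt α.1) x =ᶠ[𝓝 (chartAt E x x)] extDeriv (chartRep α.1 x) := by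
    filter_upwards [(chartAt E x).open_target.mem_nhds (mem_chart_target E x)] with y hy
    exact chartRep_extDerivAt α.2 x hy
  rw [this.extDeriv_eq, extDeriv_extDeriv_apply (r := ∞)]
  · rfl
  · exact (α.2 x).contDiffAt ((chartAt E x).open_target.mem_nhds (mem_chart_target E x))
  · exact minSmoothness_two_le

/-- A form of degree `p + q` is of type (bidegree) `(p, q)` if multiplying all its arguments by
`z` (for the complex structure of the tangent spaces) multiplies it by `z ^ p * conj z ^ q`.
In local holomorphic coordinates, `dz_I ∧ dz̄_J` with `|I| = a`, `|J| = b` is multiplied by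
`z ^ a * conj z ^ b`, so these are the forms `∑ f_{IJ} dz_I ∧ dz̄_J` with `|I| = p`, `|J| = q`. -/
def IsOfType {k : ℕ} (p q : ℕ) (α : ∀ x : X, FormAt E X k x) : Prop :=
  ∀ (x : X) (z : ℂ) (v : Fin k → TangentSpace 𝓘(ℂ, E) x),
    α x (fun i => z • v i) = z ^ p * starRingEnd ℂ z ^ q * α x v

lemma chartRep_type {k p q : ℕ} {α : ∀ x : X, FormAt E X k x}
    (h : IsOfType p q α) (c : X) (y : E) (z : ℂ)
    (v : Fin k → E) :
    chartRep α c y (fun i => z • v i) = z ^ p * (starRingEnd ℂ z) ^ q * chartRep α c y v := by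
  have := h ((chartAt E c).symm y) z
    (fun i => mfderiv 𝓘(ℂ, E) 𝓘(ℂ, E) (chartAt E c).symm y (v i))
  refine Eq.trans ?_ this
  change α _ (fun i => mfderiv 𝓘(ℂ, E) 𝓘(ℂ, E) (chartAt E c).symm y (z • v i)) = _
  congr 1
  funext i
  exact map_smul (mfderiv 𝓘(ℂ, E) 𝓘(ℂ, E) (chartAt E c).symm y) z (v i)

variable (E X) in
/-- The form `v ↦ α (z • v)`. -/
def scaleForm (k : ℕ) (z : ℂ) : SmoothForm E X k →ₗ[ℂ] SmoothForm E X k where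
  toFun α := ⟨fun x => (α.1 x).compContinuousLinearMap
      ((z • ContinuousLinearMap.id ℂ (TangentSpace 𝓘(ℂ, E) x)).restrictScalars ℝ), fun c => by
    have h : ContDiffOn ℝ ∞ (fun y => (chartRep α.1 c y).compContinuousLinearMap
        ((z • ContinuousLinearMap.id ℂ E).restrictScalars ℝ)) (chartAt E c).target :=
      (ContinuousAlternatingMap.compContinuousLinearMapCLM (F := ℂ) (ι := Fin k)
        ((z • ContinuousLinearMap.id ℂ E).restrictScalars ℝ)).contDiff.comp_contDiffOn (α.2 c)
    refine h.congr fun y _ => ?_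
    ext v
    change α.1 _ (fun i => z • mfderiv 𝓘(ℂ, E) 𝓘(ℂ, E) (chartAt E c).symm y (v i)) =
      α.1 _ (fun i => mfderiv 𝓘(ℂ, E) 𝓘(ℂ, E) (chartAt E c).symm y (z • v i))
    congr 1
    funext i
    exact (map_smul (mfderiv 𝓘(ℂ, E) 𝓘(ℂ, E) (chartAt E c).symm y) z (v i)).symm⟩
  map_add' _ _ := rfl
  map_smul' _ _ := rfl

lemma scaleForm_apply {k : ℕ} (z : ℂ) (α : SmoothForm E X k) (x : X)
    (v : Fin k → TangentSpace 𝓘(ℂ, E) x) :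
    (scaleForm E X k z α).1 x v = α.1 x (fun i => z • v i) := rfl

/-- The points `exp (π i j / (k + 1))` of the unit circle. -/
def rootPt (k j : ℕ) : ℂ := Complex.exp (Real.pi * Complex.I * j / (k + 1))

variable (E X) in
/-- The component of type `(p, q)` of a form of degree `k = p + q`, obtained by averaging
`conj w ^ p * w ^ q * α (w • v)` over the `k + 1` points `w` above. It is of type `(p, q)`
(`typeComp_type`), every form is the sum of its components (`sum_typeComp`), and a form of pure
type has no other component than itself (`typeComp_of_type`). -/
def typeComp (k p q : ℕ) : SmoothForm E X k →ₗ[ℂ] SmoothForm E X k :=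
  ((k : ℂ) + 1)⁻¹ • ∑ j ∈ Finset.range (k + 1),
    (starRingEnd ℂ (rootPt k j) ^ p * rootPt k j ^ q) • scaleForm E X k (rootPt k j)

lemma typeComp_apply {k p q : ℕ} (α : SmoothForm E X k) (x : X)
    (v : Fin k → TangentSpace 𝓘(ℂ, E) x) :
    (typeComp E X k p q α).1 x v = ((k : ℂ) + 1)⁻¹ * ∑ j ∈ Finset.range (k + 1),
      (starRingEnd ℂ (rootPt k j) ^ p * rootPt k j ^ q) *
        α.1 x (fun i => rootPt k j • v i) := by
  change SmoothForm.eval x v (typeComp E X k p q α) = _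
  rw [typeComp, LinearMap.smul_apply, LinearMap.sum_apply, map_smul, map_sum]
  rfl

lemma rootPt_sum {k p q r s : ℕ} (h : p + q = k) (h' : r + s = k) :
    ∑ j ∈ Finset.range (k + 1), (starRingEnd ℂ (rootPt k j) ^ p * rootPt k j ^ q) *
      (rootPt k j ^ r * starRingEnd ℂ (rootPt k j) ^ s) = if p = r then (k : ℂ) + 1 else 0 := by
  have hconj : ∀ j, starRingEnd ℂ (rootPt k j) = (rootPt k j)⁻¹ := by
    intro j
    rw [rootPt, ← Complex.exp_conj, ← Complex.exp_neg]
    congr 1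
    simp [Complex.conj_ofReal]
    ring
  have hne : ∀ j, rootPt k j ≠ 0 := fun j => Complex.exp_ne_zero _
  set x : ℂ := Complex.exp (2 * Real.pi * Complex.I * ((r : ℂ) - p) / (k + 1)) with hx
  have hterm : ∀ j, (starRingEnd ℂ (rootPt k j) ^ p * rootPt k j ^ q) *
      (rootPt k j ^ r * starRingEnd ℂ (rootPt k j) ^ s) = x ^ j := by
    intro j
    rw [hconj, rootPt, hx, ← Complex.exp_neg]
    simp only [← Complex.exp_nat_mul, ← Complex.exp_add]
    congr 1
    have h1 : (q : ℂ) = k - p := by rw [← h]; push_cast; ring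
    have h2 : (s : ℂ) = k - r := by rw [← h']; push_cast; ring
    rw [h1, h2]
    ring
  have hk : (k : ℂ) + 1 ≠ 0 := by exact_mod_cast Nat.succ_ne_zero k
  rw [Finset.sum_congr rfl (fun j _ => hterm j)]
  split_ifs with hpr
  · have : x = 1 := by simp [hx, hpr]
    simp [this]
  · have hx1 : x ≠ 1 := by
      intro hx1
      rw [hx, Complex.exp_eq_one_iff] at hx1
      obtain ⟨n, hn⟩ := hx1
      have h2 : ((r : ℂ) - p) = n * (k + 1) := by
        have hpi : (2 * Real.pi * Complex.I : ℂ) ≠ 0 := Complex.two_pi_I_ne_zero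
        field_simp at hn
        rw [hn, mul_comm]
      have h3 : (r : ℤ) - p = n * (k + 1) := by exact_mod_cast h2
      have hn0 : n ≠ 0 := by
        rintro rfl
        omega
      have : (k : ℤ) + 1 ≤ |(r : ℤ) - p| := by
        rw [h3, abs_mul]
        have : 1 ≤ |n| := Int.one_le_abs hn0
        rw [abs_of_pos (by positivity : (0 : ℤ) < k + 1)]
        nlinarith
      rw [le_abs] at this
      omega
    have hxk : x ^ (k + 1) = 1 := by
      rw [hx, ← Complex.exp_nat_mul, Complex.exp_eq_one_iff]
      refine ⟨(r : ℤ) - p, ?_⟩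
      push_cast
      field_simp
    have := mul_neg_geom_sum x (k + 1)
    rw [hxk, sub_self] at this
    exact (mul_eq_zero.1 this).resolve_left (sub_ne_zero.2 hx1.symm)

lemma typeComp_eq_coeff {k : ℕ} (α : SmoothForm E X k) (x : X)
    (v : Fin k → TangentSpace 𝓘(ℂ, E) x) (c : ℕ × ℕ → ℂ)
    (hc : ∀ z : ℂ, α.1 x (fun i => z • v i) =
      ∑ rs ∈ Finset.HasAntidiagonal.antidiagonal k, z ^ rs.1 * starRingEnd ℂ z ^ rs.2 * c rs)
    {p q : ℕ} (h : p + q = k) : (typeComp E X k p q α).1 x v = c (p, q) := by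
  have hk : (k : ℂ) + 1 ≠ 0 := by exact_mod_cast Nat.succ_ne_zero k
  rw [typeComp_apply]
  simp only [hc]
  simp only [Finset.mul_sum (Finset.HasAntidiagonal.antidiagonal k)]
  rw [Finset.sum_comm]
  have : ∀ rs ∈ Finset.HasAntidiagonal.antidiagonal k, (∑ j ∈ Finset.range (k + 1),
      (starRingEnd ℂ (rootPt k j) ^ p * rootPt k j ^ q) *
      (rootPt k j ^ rs.1 * starRingEnd ℂ (rootPt k j) ^ rs.2 * c rs)) =
      if rs = (p, q) then ((k : ℂ) + 1) * c rs else 0 := by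
    intro rs hrs
    have hrs' := Finset.HasAntidiagonal.mem_antidiagonal.1 hrs
    have h1 := rootPt_sum h hrs'
    simp only [← mul_assoc] at h1 ⊢
    rw [← Finset.sum_mul, h1]
    have : p = rs.1 ↔ rs = (p, q) := by
      constructor
      · intro h2; ext <;> simp <;> omega
      · rintro rfl; rfl
    simp only [this]
    split_ifs <;> simp
  rw [Finset.sum_congr rfl this, Finset.sum_ite_eq' ]
  simp [h, hk]

/-- Homogeneous polynomials of degree `k` in `z` and `conj z`. -/
def IsHomPoly (k : ℕ) (f : ℂ → ℂ) : Prop :=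
  ∃ c : ℕ × ℕ → ℂ, ∀ z : ℂ, f z =
      ∑ rs ∈ Finset.HasAntidiagonal.antidiagonal k, z ^ rs.1 * starRingEnd ℂ z ^ rs.2 * c rs

lemma IsHomPoly.sum {k : ℕ} {ι : Type*} (s : Finset ι) (f : ι → ℂ → ℂ)
    (h : ∀ i ∈ s, IsHomPoly k (f i)) : IsHomPoly k (fun z => ∑ i ∈ s, f i z) := by
  choose! c hc using h
  refine ⟨fun rs => ∑ i ∈ s, c i rs, fun z => ?_⟩
  simp only [Finset.mul_sum]
  rw [Finset.sum_comm]
  exact Finset.sum_congr rfl fun i hi => hc i hi z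

lemma IsHomPoly.monomial {k p q : ℕ} (h : p + q = k) (a : ℂ) :
    IsHomPoly k (fun z => z ^ p * starRingEnd ℂ z ^ q * a) := by
  refine ⟨fun rs => if rs = (p, q) then a else 0, fun z => ?_⟩
  simp only [mul_ite, mul_zero]
  rw [Finset.sum_ite_eq']
  simp [h]

lemma alt_poly {V : Type*} [NormedAddCommGroup V] [NormedSpace ℂ V] {k : ℕ}
    (a : V [⋀^Fin k]→L[ℝ] ℂ) (v : Fin k → V) : IsHomPoly k (fun z => a (fun i => z • v i)) := by
  classical
  have h1 : ∀ z : ℂ, a (fun i => z • v i) = ∑ t : Finset (Fin k),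
      ((∏ i, if i ∈ t then z.re else z.im : ℝ) : ℂ) *
        a (fun i => if i ∈ t then v i else Complex.I • v i) := by
    intro z
    have hz : (fun i => z • v i) = (fun i => z.re • v i) + (fun i => z.im • Complex.I • v i) := by
      funext i
      rw [Pi.add_apply]
      conv_lhs => rw [← Complex.re_add_im z]
      rw [add_smul, mul_smul]
      simp [Complex.coe_smul]
    rw [hz]
    have := a.toMultilinearMap.map_add_univ (fun i => z.re • v i) (fun i => z.im • Complex.I • v i)
    refine this.trans (Finset.sum_congr rfl fun t _ => ?_)
    have h2 := a.toMultilinearMap.map_smul_univ (fun i => if i ∈ t then z.re else z.im)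
      (fun i => if i ∈ t then v i else Complex.I • v i)
    rw [Complex.real_smul] at h2
    refine Eq.trans ?_ h2
    congr 1
    funext i
    by_cases hi : i ∈ t <;> simp [hi]
  simp only [h1]
  refine IsHomPoly.sum _ _ fun t _ => ?_
  have h2 : ∀ z : ℂ, ((∏ i, if i ∈ t then z.re else z.im : ℝ) : ℂ) =
      ∏ i, ((if i ∈ t then (1 / 2 : ℂ) else 1 / (2 * Complex.I)) * z +
        (if i ∈ t then (1 / 2 : ℂ) else -1 / (2 * Complex.I)) * starRingEnd ℂ z) := by
    intro z
    rw [Complex.ofReal_prod]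
    refine Finset.prod_congr rfl fun i _ => ?_
    split_ifs
    · rw [Complex.re_eq_add_conj]; ring
    · rw [Complex.im_eq_sub_conj]; ring
  simp only [h2, Finset.prod_add, Finset.sum_mul]
  refine IsHomPoly.sum _ _ fun s _ => ?_
  simp only [Finset.prod_mul_distrib, Finset.prod_const]
  have hcard : s.card + (Finset.univ \ s).card = k := by
    have := Finset.card_sdiff_add_card_eq_card (Finset.subset_univ s)
    rw [add_comm, this, Finset.card_univ, Fintype.card_fin]
  obtain ⟨c, hc⟩ := IsHomPoly.monomial hcard
    ((∏ i ∈ s, if i ∈ t then (1 / 2 : ℂ) else 1 / (2 * Complex.I)) *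
      (∏ i ∈ Finset.univ \ s, if i ∈ t then (1 / 2 : ℂ) else -1 / (2 * Complex.I)) *
        a (fun i => if i ∈ t then v i else Complex.I • v i))
  refine ⟨c, fun z => ?_⟩
  rw [← hc]
  ring

lemma typeComp_type {k p q : ℕ} (h : p + q = k) (α : SmoothForm E X k) :
    IsOfType p q (typeComp E X k p q α).1 := by
  intro x z v
  obtain ⟨c, hc⟩ := alt_poly (V := E) (α.1 x) v
  rw [typeComp_eq_coeff α x v c hc h, typeComp_eq_coeff α x (fun i => z • v i)
    (fun rs => z ^ rs.1 * starRingEnd ℂ z ^ rs.2 * c rs) ?_ h]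
  intro w
  have h0 : (fun i => w • z • v i) = fun i => (w * z) • v i := by
    funext i
    exact (mul_smul w z (v i)).symm
  rw [h0]
  refine (hc (w * z)).trans (Finset.sum_congr rfl fun rs _ => ?_)
  rw [map_mul]
  ring

lemma sum_typeComp {k : ℕ} (α : SmoothForm E X k) :
    ∑ rs ∈ Finset.HasAntidiagonal.antidiagonal k, typeComp E X k rs.1 rs.2 α = α := by
  refine SmoothForm.ext fun x v => ?_
  obtain ⟨c, hc⟩ := alt_poly (V := E) (α.1 x) v
  change SmoothForm.eval x v _ = _
  rw [map_sum]
  have h1 := hc 1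
  simp only [map_one, one_pow, one_mul] at h1
  have h0 : v = fun i => (1 : ℂ) • v i := by
    funext i
    exact (one_smul ℂ (v i)).symm
  refine Eq.trans ?_ (h1.symm.trans (congrArg (α.1 x) h0.symm))
  exact Finset.sum_congr rfl fun rs hrs =>
    typeComp_eq_coeff α x v c hc (Finset.HasAntidiagonal.mem_antidiagonal.1 hrs)

lemma typeComp_of_type {k p q r s : ℕ} (h : p + q = k) (h' : r + s = k) (α : SmoothForm E X k)
    (hα : IsOfType r s α.1) :
    typeComp E X k p q α = if p = r then α else 0 := by
  refine SmoothForm.ext fun x v => ?_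
  rw [typeComp_eq_coeff α x v (fun ab => if ab = (r, s) then α.1 x v else 0) ?_ h]
  · have : p = r ↔ (p, q) = (r, s) := by simp; omega
    simp only [← this]
    split_ifs <;> rfl
  · intro z
    rw [hα]
    simp only [mul_ite, mul_zero]
    rw [Finset.sum_ite_eq']
    simp [h']

lemma extDeriv_type {k p q : ℕ} {β : E → E [⋀^Fin k]→L[ℝ] ℂ} {y : E} (hβ : DifferentiableAt ℝ β y)
    (h : ∀ (y : E) (z : ℂ) (v : Fin k → E),
      β y (fun i => z • v i) = z ^ p * starRingEnd ℂ z ^ q * β y v) (v : Fin (k + 1) → E) :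
    ∃ a b : ℂ, ∀ z : ℂ, extDeriv β y (fun i => z • v i) =
      z ^ (p + 1) * starRingEnd ℂ z ^ q * a + z ^ p * starRingEnd ℂ z ^ (q + 1) * b := by
  have h1 : ∀ (z : ℂ) (u : E) (w : Fin k → E), fderiv ℝ β y u (fun i => z • w i) =
      z ^ p * starRingEnd ℂ z ^ q * fderiv ℝ β y u w := by
    intro z u w
    let L := ContinuousAlternatingMap.compContinuousLinearMapCLM (F := ℂ) (ι := Fin k)
        ((z • ContinuousLinearMap.id ℂ E).restrictScalars ℝ)
    have h2 : (fun y' => L (β y')) = fun y' => (z ^ p * starRingEnd ℂ z ^ q) • β y' := by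
      funext y'
      ext w
      exact h y' z w
    have h3 : fderiv ℝ (fun y' => L (β y')) y = L ∘L fderiv ℝ β y :=
      (L.hasFDerivAt.comp y hβ.hasFDerivAt).fderiv
    have h4 : fderiv ℝ (fun y' => (z ^ p * starRingEnd ℂ z ^ q) • β y') y =
        (z ^ p * starRingEnd ℂ z ^ q) • fderiv ℝ β y := by
      exact fderiv_const_smul (𝕜 := ℝ) hβ (z ^ p * starRingEnd ℂ z ^ q)
    rw [h2, h4] at h3
    exact (congrArg (fun f => f u w) h3).symm
  have h2 : ∀ (z : ℂ) (u : E) (w : Fin k → E), fderiv ℝ β y (z • u) w =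
      z * ((fderiv ℝ β y u w - Complex.I * fderiv ℝ β y (Complex.I • u) w) / 2) +
      starRingEnd ℂ z *
        ((fderiv ℝ β y u w + Complex.I * fderiv ℝ β y (Complex.I • u) w) / 2) := by
    intro z u w
    have hz : z • u = z.re • u + z.im • Complex.I • u := by
      conv_lhs => rw [← Complex.re_add_im z]
      rw [add_smul, mul_smul]
      simp [Complex.coe_smul]
    rw [hz, map_add, map_smul, map_smul, ContinuousAlternatingMap.add_apply,
      ContinuousAlternatingMap.smul_apply, ContinuousAlternatingMap.smul_apply,
      Complex.real_smul, Complex.real_smul, Complex.re_eq_add_conj, Complex.im_eq_sub_conj]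
    field_simp
    ring_nf
    simp only [Complex.I_sq]
    ring
  refine ⟨∑ i : Fin (k + 1), (-1) ^ i.val * ((fderiv ℝ β y (v i) (i.removeNth v) -
      Complex.I * fderiv ℝ β y (Complex.I • v i) (i.removeNth v)) / 2),
    ∑ i : Fin (k + 1), (-1) ^ i.val * ((fderiv ℝ β y (v i) (i.removeNth v) +
      Complex.I * fderiv ℝ β y (Complex.I • v i) (i.removeNth v)) / 2), fun z => ?_⟩
  rw [extDeriv, ContinuousAlternatingMap.alternatizeUncurryFin_apply, Finset.mul_sum,
    Finset.mul_sum, ← Finset.sum_add_distrib]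
  refine Finset.sum_congr rfl fun i _ => ?_
  have h3 : i.removeNth (fun i => z • v i) = fun j => z • i.removeNth v j := rfl
  rw [h3, h1, h2]
  simp only [zsmul_eq_mul, Int.cast_pow, Int.cast_neg, Int.cast_one]
  ring

lemma typeComp_extD_eq_zero [IsManifold 𝓘(ℂ, E) ω X] {k p q r s : ℕ} (h : p + q = k) (h' : r + s = k + 1)
    (h1 : r ≠ p + 1) (h2 : r ≠ p) (α : SmoothForm E X k)
    (hα : IsOfType p q α.1) :
    typeComp E X (k + 1) r s (extD E X k α) = 0 := by
  refine SmoothForm.ext fun x v => ?_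
  obtain ⟨a, b, hab⟩ := extDeriv_type (differentiableAt_chartRep α.2 x)
    (fun y z v => chartRep_type hα x y z v)
    (fun i => mfderiv 𝓘(ℂ, E) 𝓘(ℂ, E) (chartAt E x) x (v i))
  rw [typeComp_eq_coeff (extD E X k α) x v
    (fun ab => if ab = (p + 1, q) then a else if ab = (p, q + 1) then b else 0) ?_ h']
  · have e1 : (r, s) ≠ (p + 1, q) := by simp [h1]
    have e2 : (r, s) ≠ (p, q + 1) := by simp [h2]
    simp only [e1, e2, if_false]
    rfl
  · intro z
    have h3 : (extD E X k α).1 x (fun i => z • v i) = extDeriv (chartRep α.1 x) (chartAt E x x)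
        (fun i => z • mfderiv 𝓘(ℂ, E) 𝓘(ℂ, E) (chartAt E x) x (v i)) := by
      change extDeriv (chartRep α.1 x) (chartAt E x x)
        (fun i => mfderiv 𝓘(ℂ, E) 𝓘(ℂ, E) (chartAt E x) x (z • v i)) = _
      congr 1
      funext i
      exact map_smul (mfderiv 𝓘(ℂ, E) 𝓘(ℂ, E) (chartAt E x) x) z (v i)
    refine (h3.trans (hab z)).trans ?_
    have h4 : ∀ ab : ℕ × ℕ, (if ab = (p + 1, q) then a else if ab = (p, q + 1) then b else 0) =
        (if ab = (p + 1, q) then a else 0) + if ab = (p, q + 1) then b else 0 := by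
      intro ab
      split_ifs with e1 e2
      · rw [e1] at e2; simp at e2
      · simp
      · simp
      · simp
    simp only [h4, mul_add, Finset.sum_add_distrib, mul_ite, mul_zero]
    rw [Finset.sum_ite_eq', Finset.sum_ite_eq']
    have e1 : p + 1 + q = k + 1 := by omega
    have e2 : p + (q + 1) = k + 1 := by omega
    simp [e1, e2]

lemma sum_typeComp_of_type {k p q : ℕ} (h : p + q = k) {M : Type*} [AddCommMonoid M] [Module ℂ M]
    (F : ℕ × ℕ → SmoothForm E X k →ₗ[ℂ] M) (α : SmoothForm E X k) (hα : IsOfType p q α.1) :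
    ∑ rs ∈ Finset.HasAntidiagonal.antidiagonal k, F rs (typeComp E X k rs.1 rs.2 α) =
      F (p, q) α := by
  rw [Finset.sum_eq_single (p, q)]
  · rw [typeComp_of_type h h α hα, if_pos rfl]
  · intro rs hrs hne
    have hrs' := Finset.HasAntidiagonal.mem_antidiagonal.1 hrs
    rw [typeComp_of_type hrs' h α hα, if_neg, map_zero]
    intro h1
    apply hne
    ext <;> simp <;> omega
  · intro h1
    exact absurd (Finset.HasAntidiagonal.mem_antidiagonal.2 h) h1

/-- Linear maps that agree on all forms of pure type agree. -/
lemma ext_of_type {k : ℕ} {M : Type*} [AddCommGroup M] [Module ℂ M]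
    (F G : SmoothForm E X k →ₗ[ℂ] M)
    (h : ∀ (p q : ℕ) (α : SmoothForm E X k), p + q = k → IsOfType p q α.1 → F α = G α)
    (α : SmoothForm E X k) : F α = G α := by
  rw [← sum_typeComp α, map_sum, map_sum]
  refine Finset.sum_congr rfl fun rs hrs => ?_
  have h1 := Finset.HasAntidiagonal.mem_antidiagonal.1 hrs
  exact h _ _ _ h1 (typeComp_type h1 α)

section Degreewise

variable [IsManifold 𝓘(ℂ, E) ω X]

variable (E X) in
/-- The operator `∂` on `k`-forms: the sum over `p + q = k` of the component of type `(p + 1, q)`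
of `d` applied to the component of type `(p, q)`. -/
def delDeg (k : ℕ) : SmoothForm E X k →ₗ[ℂ] SmoothForm E X (k + 1) :=
  ∑ pq ∈ Finset.HasAntidiagonal.antidiagonal k,
    typeComp E X (k + 1) (pq.1 + 1) pq.2 ∘ₗ extD E X k ∘ₗ typeComp E X k pq.1 pq.2

lemma delDeg_apply {k : ℕ} (α : SmoothForm E X k) :
    delDeg E X k α = ∑ pq ∈ Finset.HasAntidiagonal.antidiagonal k,
      typeComp E X (k + 1) (pq.1 + 1) pq.2 (extD E X k (typeComp E X k pq.1 pq.2 α)) :=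
  LinearMap.sum_apply _ _ _

variable (E X) in
/-- The operator `∂̄` on `k`-forms: the sum over `p + q = k` of the component of type `(p, q + 1)`
of `d` applied to the component of type `(p, q)`. -/
def delbarDeg (k : ℕ) : SmoothForm E X k →ₗ[ℂ] SmoothForm E X (k + 1) :=
  ∑ pq ∈ Finset.HasAntidiagonal.antidiagonal k,
    typeComp E X (k + 1) pq.1 (pq.2 + 1) ∘ₗ extD E X k ∘ₗ typeComp E X k pq.1 pq.2

lemma delbarDeg_apply {k : ℕ} (α : SmoothForm E X k) :
    delbarDeg E X k α = ∑ pq ∈ Finset.HasAntidiagonal.antidiagonal k,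
      typeComp E X (k + 1) pq.1 (pq.2 + 1) (extD E X k (typeComp E X k pq.1 pq.2 α)) :=
  LinearMap.sum_apply _ _ _

lemma delDeg_of_type {k p q : ℕ} (h : p + q = k) (α : SmoothForm E X k)
    (hα : IsOfType p q α.1) :
    delDeg E X k α = typeComp E X (k + 1) (p + 1) q (extD E X k α) := by
  rw [delDeg_apply]
  exact sum_typeComp_of_type h
    (fun rs => typeComp E X (k + 1) (rs.1 + 1) rs.2 ∘ₗ extD E X k) α hα

lemma delbarDeg_of_type {k p q : ℕ} (h : p + q = k) (α : SmoothForm E X k)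
    (hα : IsOfType p q α.1) :
    delbarDeg E X k α = typeComp E X (k + 1) p (q + 1) (extD E X k α) := by
  rw [delbarDeg_apply]
  exact sum_typeComp_of_type h
    (fun rs => typeComp E X (k + 1) rs.1 (rs.2 + 1) ∘ₗ extD E X k) α hα

lemma delDeg_type {k p q : ℕ} (h : p + q = k) (α : SmoothForm E X k)
    (hα : IsOfType p q α.1) : IsOfType (p + 1) q (delDeg E X k α).1 := by
  rw [delDeg_of_type h α hα]
  exact typeComp_type (by omega) _

lemma delbarDeg_type {k p q : ℕ} (h : p + q = k) (α : SmoothForm E X k)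
    (hα : IsOfType p q α.1) : IsOfType p (q + 1) (delbarDeg E X k α).1 := by
  rw [delbarDeg_of_type h α hα]
  exact typeComp_type (by omega) _

lemma extD_of_type {k p q : ℕ} (h : p + q = k) (α : SmoothForm E X k)
    (hα : IsOfType p q α.1) :
    delDeg E X k α + delbarDeg E X k α = extD E X k α := by
  rw [delDeg_of_type h α hα, delbarDeg_of_type h α hα]
  conv_rhs => rw [← sum_typeComp (extD E X k α)]
  have hne : ((p + 1, q) : ℕ × ℕ) ≠ (p, q + 1) := by simp
  rw [← Finset.sum_subset (s₁ := {(p + 1, q), (p, q + 1)}), Finset.sum_pair hne]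
  · intro rs hrs
    simp only [Finset.mem_insert, Finset.mem_singleton] at hrs
    rw [Finset.HasAntidiagonal.mem_antidiagonal]
    rcases hrs with rfl | rfl <;> simp <;> omega
  · intro rs hrs hrs'
    have h1 := Finset.HasAntidiagonal.mem_antidiagonal.1 hrs
    simp only [Finset.mem_insert, Finset.mem_singleton, not_or] at hrs'
    refine typeComp_extD_eq_zero h h1 ?_ ?_ α hα
    · intro h2
      exact hrs'.1 (by ext <;> simp <;> omega)
    · intro h2
      exact hrs'.2 (by ext <;> simp <;> omega)

lemma delDeg_add_delbarDeg {k : ℕ} (α : SmoothForm E X k) :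
    delDeg E X k α + delbarDeg E X k α = extD E X k α :=
  ext_of_type (delDeg E X k + delbarDeg E X k) (extD E X k)
    (fun _ _ α h hα => extD_of_type h α hα) α

lemma squares_of_type {k p q : ℕ} (h : p + q = k) (α : SmoothForm E X k)
    (hα : IsOfType p q α.1) :
    delDeg E X (k + 1) (delDeg E X k α) = 0 ∧ delbarDeg E X (k + 1) (delbarDeg E X k α) = 0 ∧
      delDeg E X (k + 1) (delbarDeg E X k α) + delbarDeg E X (k + 1) (delDeg E X k α) = 0 := by
  have ta := delDeg_type h α hα
  have tb := delbarDeg_type h α hα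
  have taa := delDeg_type (by omega) _ ta
  have tab := delbarDeg_type (by omega) _ ta
  have tba := delDeg_type (by omega) _ tb
  have tbb := delbarDeg_type (by omega) _ tb
  have h0 := extD_extD k α
  rw [← delDeg_add_delbarDeg α, map_add, ← delDeg_add_delbarDeg, ← delDeg_add_delbarDeg] at h0
  refine ⟨?_, ?_, ?_⟩
  · have h1 := congrArg (typeComp E X (k + 1 + 1) (p + 1 + 1) q) h0
    simp only [map_add, map_zero] at h1
    rw [typeComp_of_type (by omega) (by omega) _ taa, typeComp_of_type (by omega) (by omega) _ tab,
      typeComp_of_type (by omega) (by omega) _ tba,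
      typeComp_of_type (by omega) (by omega) _ tbb] at h1
    simpa [show ¬ (p + 1 + 1 = p) by omega, show ¬ (p = p + 1 + 1) by omega] using h1
  · have h1 := congrArg (typeComp E X (k + 1 + 1) p (q + 1 + 1)) h0
    simp only [map_add, map_zero] at h1
    rw [typeComp_of_type (by omega) (by omega) _ taa, typeComp_of_type (by omega) (by omega) _ tab,
      typeComp_of_type (by omega) (by omega) _ tba,
      typeComp_of_type (by omega) (by omega) _ tbb] at h1
    simpa [show ¬ (p + 1 + 1 = p) by omega, show ¬ (p = p + 1 + 1) by omega] using h1
  · have h1 := congrArg (typeComp E X (k + 1 + 1) (p + 1) (q + 1)) h0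
    simp only [map_add, map_zero] at h1
    rw [typeComp_of_type (by omega) (by omega) _ taa, typeComp_of_type (by omega) (by omega) _ tab,
      typeComp_of_type (by omega) (by omega) _ tba,
      typeComp_of_type (by omega) (by omega) _ tbb] at h1
    simpa [add_comm] using h1

end Degreewise

section Total

variable (E X)

/-- Smooth complex-valued forms of all degrees; `α k` is the part of degree `k` of `α`. -/
abbrev Forms : Type _ := ∀ k : ℕ, SmoothForm E X k

variable {E X} in
/-- The operator on forms that acts on `k`-forms as `D k`, raising the degree by one. -/
def raise (D : ∀ k : ℕ, SmoothForm E X k →ₗ[ℂ] SmoothForm E X (k + 1)) :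
    Forms E X →ₗ[ℂ] Forms E X :=
  LinearMap.pi fun k => match k with
    | 0 => 0
    | j + 1 => D j ∘ₗ LinearMap.proj j

/-- The space of smooth `k`-forms inside the space of all forms; it is zero if `k < 0`. -/
def homogeneousForms (k : ℤ) : Submodule ℂ (Forms E X) where
  carrier := {α | ∀ j : ℕ, (j : ℤ) ≠ k → α j = 0}
  add_mem' := fun ha hb j hj => by rw [Pi.add_apply, ha j hj, hb j hj, add_zero]
  zero_mem' := fun _ _ => rfl
  smul_mem' := fun c a ha j hj => by rw [Pi.smul_apply, ha j hj, smul_zero]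

/-- The space of smooth forms of bidegree `(p, q)` inside the space of all forms; it is zero if
`p < 0` or `q < 0`. -/
def bidegreeForms (p q : ℤ) : Submodule ℂ (Forms E X) where
  carrier := {α | ∀ k : ℕ, (0 ≤ p ∧ 0 ≤ q ∧ p + q = k → IsOfType p.toNat q.toNat (α k).1) ∧
    (¬ (0 ≤ p ∧ 0 ≤ q ∧ p + q = k) → α k = 0)}
  add_mem' := by
    intro a b ha hb k
    refine ⟨fun h x z v => ?_, fun h => ?_⟩
    · have h1 := (ha k).1 h x z v
      have h2 := (hb k).1 h x z v
      change (a k).1 x _ + (b k).1 x _ = _ * ((a k).1 x v + (b k).1 x v)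
      rw [h1, h2, mul_add]
    · rw [Pi.add_apply, (ha k).2 h, (hb k).2 h, add_zero]
  zero_mem' := by
    refine fun k => ⟨fun h x z v => ?_, fun _ => rfl⟩
    exact (mul_zero _).symm
  smul_mem' := by
    intro c a ha k
    refine ⟨fun h x z v => ?_, fun h => ?_⟩
    · have h1 := (ha k).1 h x z v
      change c * (a k).1 x _ = _ * (c * (a k).1 x v)
      rw [h1, mul_left_comm]
    · rw [Pi.smul_apply, (ha k).2 h, smul_zero]

open Classical in
/-- The component of bidegree `(p, q)` of a form. -/
def component (p q : ℤ) : Forms E X →ₗ[ℂ] Forms E X :=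
  LinearMap.pi fun k =>
    if 0 ≤ p ∧ 0 ≤ q ∧ p + q = k then typeComp E X k p.toNat q.toNat ∘ₗ LinearMap.proj k else 0

lemma component_mem (p q : ℤ) (α : Forms E X) : component E X p q α ∈ bidegreeForms E X p q := by
  refine fun k => ⟨fun h => ?_, fun h => ?_⟩
  · rw [component, LinearMap.pi_apply, if_pos h]
    exact typeComp_type (by omega) (α k)
  · rw [component, LinearMap.pi_apply, if_neg h]
    rfl

variable [IsManifold 𝓘(ℂ, E) ω X]

/-- The exterior derivative `d`. -/
def d : Forms E X →ₗ[ℂ] Forms E X := raise (extD E X)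

/-- The operator `∂`. -/
def del : Forms E X →ₗ[ℂ] Forms E X := raise (delDeg E X)

/-- The operator `∂̄`. -/
def delbar : Forms E X →ₗ[ℂ] Forms E X := raise (delbarDeg E X)

variable {E X}

lemma del_add_delbar (α : Forms E X) : del E X α + delbar E X α = d E X α := by
  funext k
  cases k with
  | zero => exact add_zero _
  | succ j => exact delDeg_add_delbarDeg (α j)

lemma del_del (α : Forms E X) : del E X (del E X α) = 0 := by
  funext k
  match k with
  | 0 => rfl
  | 1 => exact map_zero (delDeg E X 0)
  | j + 2 =>
    exact ext_of_type (delDeg E X (j + 1) ∘ₗ delDeg E X j) 0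
      (fun _ _ α h hα => (squares_of_type h α hα).1) (α j)

lemma delbar_delbar (α : Forms E X) : delbar E X (delbar E X α) = 0 := by
  funext k
  match k with
  | 0 => rfl
  | 1 => exact map_zero (delbarDeg E X 0)
  | j + 2 =>
    exact ext_of_type (delbarDeg E X (j + 1) ∘ₗ delbarDeg E X j) 0
      (fun _ _ α h hα => (squares_of_type h α hα).2.1) (α j)

lemma del_delbar (α : Forms E X) : del E X (delbar E X α) = - delbar E X (del E X α) := by
  rw [eq_neg_iff_add_eq_zero]
  funext k
  match k with
  | 0 => exact add_zero _
  | 1 =>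
    change delDeg E X 0 0 + delbarDeg E X 0 0 = 0
    simp
  | j + 2 =>
    exact ext_of_type (delDeg E X (j + 1) ∘ₗ delbarDeg E X j +
      delbarDeg E X (j + 1) ∘ₗ delDeg E X j) 0
      (fun _ _ α h hα => (squares_of_type h α hα).2.2) (α j)

lemma del_mem {p q p' : ℤ} (hp : p' = p + 1) {α : Forms E X} (hα : α ∈ bidegreeForms E X p q) :
    del E X α ∈ bidegreeForms E X p' q := by
  subst hp
  intro k
  cases k with
  | zero => exact ⟨fun _ x z v => (mul_zero _).symm, fun _ => rfl⟩
  | succ j =>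
    by_cases h : 0 ≤ p ∧ 0 ≤ q ∧ p + q = j
    · refine ⟨fun _ => ?_, fun h' => absurd ⟨by omega, by omega, by push_cast; omega⟩ h'⟩
      have h1 : (p + 1).toNat = p.toNat + 1 := by omega
      rw [h1]
      exact delDeg_type (by omega) (α j) ((hα j).1 h)
    · have h0 : del E X α (j + 1) = 0 := by
        change delDeg E X j (α j) = 0
        rw [(hα j).2 h, map_zero]
      rw [h0]
      exact ⟨fun _ x z v => (mul_zero _).symm, fun _ => rfl⟩

lemma delbar_mem {p q q' : ℤ} (hq : q' = q + 1) {α : Forms E X}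
    (hα : α ∈ bidegreeForms E X p q) : delbar E X α ∈ bidegreeForms E X p q' := by
  subst hq
  intro k
  cases k with
  | zero => exact ⟨fun _ x z v => (mul_zero _).symm, fun _ => rfl⟩
  | succ j =>
    by_cases h : 0 ≤ p ∧ 0 ≤ q ∧ p + q = j
    · refine ⟨fun _ => ?_, fun h' => absurd ⟨by omega, by omega, by push_cast; omega⟩ h'⟩
      have h1 : (q + 1).toNat = q.toNat + 1 := by omega
      rw [h1]
      exact delbarDeg_type (by omega) (α j) ((hα j).1 h)
    · have h0 : delbar E X α (j + 1) = 0 := by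
        change delbarDeg E X j (α j) = 0
        rw [(hα j).2 h, map_zero]
      rw [h0]
      exact ⟨fun _ x z v => (mul_zero _).symm, fun _ => rfl⟩

end Total

section Pages

variable (E X)
variable [IsManifold 𝓘(ℂ, E) ω X]

/-- The `d`-closed `k`-forms. -/
def closedForms (k : ℤ) : Submodule ℂ (Forms E X) :=
  homogeneousForms E X k ⊓ LinearMap.ker (d E X)

/-- The `d`-exact `k`-forms. -/
def exactForms (k : ℤ) : Submodule ℂ (Forms E X) :=
  (homogeneousForms E X (k - 1)).map (d E X)

/-- The de Rham cohomology of `X` with complex coefficients in degree `k`. -/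
abbrev DeRham (k : ℤ) : Type _ := closedForms E X k ⧸ (exactForms E X k).submoduleOf (closedForms E X k)

/-- The de Rham class of a closed form. -/
def DeRham.mk (k : ℤ) : closedForms E X k →ₗ[ℂ] DeRham E X k := Submodule.mkQ _

/-- The `∂̄`-closed forms of bidegree `(p, q)`. -/
def dolbeaultCycles (p q : ℤ) : Submodule ℂ (Forms E X) :=
  bidegreeForms E X p q ⊓ LinearMap.ker (delbar E X)

/-- The `∂̄`-exact forms of bidegree `(p, q)`. -/
def dolbeaultBoundaries (p q : ℤ) : Submodule ℂ (Forms E X) :=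
  (bidegreeForms E X p (q - 1)).map (delbar E X)

/-- The first page of the Frölicher spectral sequence: Dolbeault cohomology, which is the
cohomology of the forms of bidegree `(p, q)` with respect to `d₀ = ∂̄`. -/
abbrev E1 (p q : ℤ) : Type _ :=
  dolbeaultCycles E X p q ⧸ (dolbeaultBoundaries E X p q).submoduleOf (dolbeaultCycles E X p q)

/-- The Dolbeault class of a `∂̄`-closed form. -/
def E1.mk (p q : ℤ) : dolbeaultCycles E X p q →ₗ[ℂ] E1 E X p q := Submodule.mkQ _

variable {E X} in
lemma del_dolbeaultCycles {p p' q : ℤ} (hp : p' = p + 1) (α : Forms E X)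
    (hα : α ∈ dolbeaultCycles E X p q) : del E X α ∈ dolbeaultCycles E X p' q := by
  refine ⟨del_mem hp hα.1, ?_⟩
  have h := del_delbar α
  rw [LinearMap.mem_ker.1 hα.2, map_zero] at h
  exact neg_eq_zero.1 h.symm

/-- The differential `d₁` of the first page, `[α] ↦ [∂α]`, from bidegree `(p, q)` to bidegree
`(p + 1, q)`. -/
def d1 {p p' : ℤ} (hp : p' = p + 1) (q : ℤ) : E1 E X p q →ₗ[ℂ] E1 E X p' q :=
  Submodule.mapQ _ _ ((del E X).restrict fun α hα => del_dolbeaultCycles hp α hα) (by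
    rintro ⟨α, hα⟩ ⟨v, hv, hvα⟩
    refine ⟨- del E X v, neg_mem (del_mem hp hv), ?_⟩
    rw [map_neg, ← del_delbar, hvα]
    rfl)

/-- The kernel of `d₁` in bidegree `(p, q)`. -/
def d1Cycles (p q : ℤ) : Submodule ℂ (E1 E X p q) := LinearMap.ker (d1 E X (rfl : p + 1 = p + 1) q)

/-- The image of `d₁` in bidegree `(p, q)`. -/
def d1Boundaries (p q : ℤ) : Submodule ℂ (E1 E X p q) :=
  LinearMap.range (d1 E X (sub_add_cancel p 1).symm q)

/-- The second page of the Frölicher spectral sequence: the cohomology of the first page. -/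
abbrev E2 (p q : ℤ) : Type _ :=
  d1Cycles E X p q ⧸ (d1Boundaries E X p q).submoduleOf (d1Cycles E X p q)

/-- The forms `α` of bidegree `(p, q)` that define a class on the second page: `∂̄α = 0`, and `∂α`
is `∂̄`-exact. -/
def e2Cycles (p q : ℤ) : Submodule ℂ (Forms E X) where
  carrier := {α | α ∈ dolbeaultCycles E X p q ∧
    ∃ u ∈ bidegreeForms E X (p + 1) (q - 1), del E X α = delbar E X u}
  add_mem' := by
    rintro a b ⟨ha, u, hu, hau⟩ ⟨hb, w, hw, hbw⟩
    exact ⟨add_mem ha hb, u + w, add_mem hu hw, by rw [map_add, map_add, hau, hbw]⟩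
  zero_mem' := ⟨zero_mem _, 0, zero_mem _, by rw [map_zero, map_zero]⟩
  smul_mem' := by
    rintro c a ⟨ha, u, hu, hau⟩
    exact ⟨Submodule.smul_mem _ c ha, c • u, Submodule.smul_mem _ c hu,
      by rw [map_smul, map_smul, hau]⟩

lemma e2Cycles_le (p q : ℤ) : e2Cycles E X p q ≤ dolbeaultCycles E X p q := fun _ h => h.1

variable {E X} in
lemma E1.mk_mem_d1Cycles {p q : ℤ} (α : dolbeaultCycles E X p q) :
    E1.mk E X p q α ∈ d1Cycles E X p q ↔ α.1 ∈ e2Cycles E X p q := by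
  have h1 : E1.mk E X p q α ∈ d1Cycles E X p q ↔
      del E X α.1 ∈ dolbeaultBoundaries E X (p + 1) q := by
    rw [d1Cycles, LinearMap.mem_ker, E1.mk, d1, Submodule.mkQ_apply, Submodule.mapQ_apply,
      Submodule.Quotient.mk_eq_zero]
    rfl
  rw [h1]
  constructor
  · rintro ⟨u, hu, hau⟩
    exact ⟨α.2, u, hu, hau.symm⟩
  · rintro ⟨_, u, hu, hau⟩
    exact ⟨u, hu, hau.symm⟩

/-- The double class `[[α]]` of such a form `α`. -/
def E2.mk (p q : ℤ) : e2Cycles E X p q →ₗ[ℂ] E2 E X p q :=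
  Submodule.mkQ _ ∘ₗ LinearMap.codRestrict (d1Cycles E X p q)
    (E1.mk E X p q ∘ₗ Submodule.inclusion (e2Cycles_le E X p q))
    fun α => (E1.mk_mem_d1Cycles (Submodule.inclusion (e2Cycles_le E X p q) α)).2 α.2

lemma E2.mk_surjective (p q : ℤ) : Function.Surjective (E2.mk E X p q) := by
  intro y
  obtain ⟨⟨x, hx⟩, rfl⟩ := Submodule.mkQ_surjective _ y
  obtain ⟨α, rfl⟩ := Submodule.mkQ_surjective _ x
  exact ⟨⟨α.1, (E1.mk_mem_d1Cycles α).1 hx⟩, rfl⟩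

variable {E X} in
lemma E2.mk_eq_zero {p q : ℤ} (α : e2Cycles E X p q) : E2.mk E X p q α = 0 ↔
    ∃ u ∈ dolbeaultCycles E X (p - 1) q, ∃ v ∈ bidegreeForms E X p (q - 1),
      α.1 = del E X u + delbar E X v := by
  have h1 : E2.mk E X p q α = 0 ↔
      E1.mk E X p q (Submodule.inclusion (e2Cycles_le E X p q) α) ∈ d1Boundaries E X p q := by
    rw [E2.mk, LinearMap.comp_apply, Submodule.mkQ_apply, Submodule.Quotient.mk_eq_zero]
    rfl
  have hp : p = p - 1 + 1 := (sub_add_cancel p 1).symm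
  have h2 : ∀ u : dolbeaultCycles E X (p - 1) q,
      d1 E X hp q (E1.mk E X (p - 1) q u) =
        E1.mk E X p q (Submodule.inclusion (e2Cycles_le E X p q) α) ↔
      α.1 - del E X u.1 ∈ dolbeaultBoundaries E X p q := by
    intro u
    rw [eq_comm, E1.mk, E1.mk, d1, Submodule.mkQ_apply, Submodule.mkQ_apply, Submodule.mapQ_apply,
      Submodule.Quotient.eq]
    rfl
  rw [h1]
  constructor
  · rintro ⟨y, hy⟩
    obtain ⟨u, rfl⟩ := Submodule.mkQ_surjective _ y
    obtain ⟨v, hv, h⟩ := (h2 u).1 hy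
    exact ⟨u.1, u.2, v, hv, by rw [h]; abel⟩
  · rintro ⟨u, hu, v, hv, h⟩
    exact ⟨E1.mk E X (p - 1) q ⟨u, hu⟩, (h2 ⟨u, hu⟩).2 ⟨v, hv, by rw [h]; abel⟩⟩

/-- The pairs `(α, u)` with `α` of bidegree `(p, q)`, `∂̄α = 0` and `∂α = ∂̄u`. -/
def d2Pairs (p q : ℤ) : Submodule ℂ (Forms E X × Forms E X) where
  carrier := {w | w.1 ∈ dolbeaultCycles E X p q ∧ w.2 ∈ bidegreeForms E X (p + 1) (q - 1) ∧
    del E X w.1 = delbar E X w.2}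
  add_mem' := by
    rintro a b ⟨ha, hu, hau⟩ ⟨hb, hw, hbw⟩
    exact ⟨add_mem ha hb, add_mem hu hw, by
      rw [Prod.fst_add, Prod.snd_add, map_add, map_add, hau, hbw]⟩
  zero_mem' := ⟨zero_mem _, zero_mem _, by simp⟩
  smul_mem' := by
    rintro c a ⟨ha, hu, hau⟩
    exact ⟨Submodule.smul_mem _ c ha, Submodule.smul_mem _ c hu,
      by rw [Prod.smul_fst, Prod.smul_snd, map_smul, map_smul, hau]⟩

/-- The map `(α, u) ↦ [[α]]` on such pairs. -/
def d2Source (p q : ℤ) : d2Pairs E X p q →ₗ[ℂ] E2 E X p q :=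
  E2.mk E X p q ∘ₗ LinearMap.codRestrict (e2Cycles E X p q)
    (LinearMap.fst ℂ _ _ ∘ₗ (d2Pairs E X p q).subtype) fun w => ⟨w.2.1, w.1.2, w.2.2.1, w.2.2.2⟩

variable {E X} in
lemma del_mem_e2Cycles {p q p' q' : ℤ} (hp : p' = p + 2) (hq : q' = q - 1) {α u : Forms E X}
    (hu : u ∈ bidegreeForms E X (p + 1) (q - 1)) (h : del E X α = delbar E X u) :
    del E X u ∈ e2Cycles E X p' q' := by
  subst hq
  refine ⟨⟨del_mem (by omega) hu, ?_⟩, 0, zero_mem _, ?_⟩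
  · have h1 := del_delbar u
    rw [← h, del_del] at h1
    exact neg_eq_zero.1 h1.symm
  · rw [del_del, map_zero]

/-- The map `(α, u) ↦ [[∂u]]` on such pairs. -/
def d2Target {p q p' q' : ℤ} (hp : p' = p + 2) (hq : q' = q - 1) :
    d2Pairs E X p q →ₗ[ℂ] E2 E X p' q' :=
  E2.mk E X p' q' ∘ₗ LinearMap.codRestrict (e2Cycles E X p' q')
    (del E X ∘ₗ LinearMap.snd ℂ _ _ ∘ₗ (d2Pairs E X p q).subtype)
    fun w => del_mem_e2Cycles hp hq w.2.2.1 w.2.2.2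

lemma d2Source_surjective (p q : ℤ) : Function.Surjective (d2Source E X p q) := by
  intro y
  obtain ⟨⟨α, hα, u, hu, h⟩, rfl⟩ := E2.mk_surjective E X p q y
  exact ⟨⟨(α, u), hα, hu, h⟩, rfl⟩

lemma ker_d2Source_le {p q p' q' : ℤ} (hp : p' = p + 2) (hq : q' = q - 1) :
    LinearMap.ker (d2Source E X p q) ≤ LinearMap.ker (d2Target E X hp hq) := by
  rintro ⟨⟨α, w⟩, hα, hw, h⟩ h0
  obtain ⟨u, hu, v, hv, huv⟩ := (E2.mk_eq_zero _).1 (LinearMap.mem_ker.1 h0)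
  refine LinearMap.mem_ker.2 ((E2.mk_eq_zero _).2 ⟨w + del E X v, ⟨?_, ?_⟩, 0, zero_mem _, ?_⟩)
  · subst hp hq
    have : p + 2 - 1 = p + 1 := by ring
    rw [this]
    exact add_mem hw (del_mem rfl hv)
  · change α = _ at huv
    change del E X α = delbar E X w at h
    change delbar E X (w + del E X v) = 0
    rw [map_add, ← h, huv, map_add, del_del, zero_add, del_delbar, neg_add_cancel]
  · change del E X w = _
    rw [map_add, del_del, add_zero, map_zero, add_zero]

/-- The differential `d₂` of the second page, from bidegree `(p, q)` to bidegree
`(p + 2, q - 1)`: it sends `[[α]]` to `[[∂u]]`, where `u` is any form with `∂α = ∂̄u`, see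
`d2_mk`. -/
def d2 {p q p' q' : ℤ} (hp : p' = p + 2) (hq : q' = q - 1) : E2 E X p q →ₗ[ℂ] E2 E X p' q' :=
  (LinearMap.ker (d2Source E X p q)).liftQ (d2Target E X hp hq) (ker_d2Source_le E X hp hq) ∘ₗ
    ((d2Source E X p q).quotKerEquivOfSurjective (d2Source_surjective E X p q)).symm.toLinearMap

variable {E X} in
lemma d2_mk {p q p' q' : ℤ} (hp : p' = p + 2) (hq : q' = q - 1) (α : e2Cycles E X p q)
    (u : Forms E X) (hu : u ∈ bidegreeForms E X (p + 1) (q - 1))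
    (h : del E X α.1 = delbar E X u) :
    d2 E X hp hq (E2.mk E X p q α) = E2.mk E X p' q' ⟨del E X u, del_mem_e2Cycles hp hq hu h⟩ := by
  let w : d2Pairs E X p q := ⟨(α.1, u), α.2.1, hu, h⟩
  have h1 : E2.mk E X p q α = d2Source E X p q w := rfl
  have h2 : ((d2Source E X p q).quotKerEquivOfSurjective (d2Source_surjective E X p q)).symm
      (d2Source E X p q w) = Submodule.Quotient.mk w := by
    rw [LinearEquiv.symm_apply_eq]
    rfl
  rw [h1, d2, LinearMap.comp_apply, LinearEquiv.coe_coe, h2, Submodule.liftQ_apply]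
  rfl

end Pages

end

end ComplexManifold

open ComplexManifold

/-! Write `n` for the dimension. A form of bidegree `(p, q)` vanishes when `p > n` or `q > n`, and
`(dα)^{p,q} = ∂α^{p-1,q} + ∂̄α^{p,q-1}` (`component_d`). The proposition follows from these two
facts.

For a closed `α` of degree `2n - 2`, the form `α^{n-2,n}` is `∂̄`-closed because there is nothing in
bidegree `(n-2, n+1)`, and `∂α^{n-2,n} = ∂̄u` with `u = -α^{n-1,n-1}`. If `α = dβ`, then `α^{n-2,n}
= ∂β^{n-3,n} + ∂̄β^{n-2,n-1}` with `β^{n-3,n}` automatically `∂̄`-closed, so the double class is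
zero. Moreover `∂u = ∂̄α^{n,n-2}`, so `d₂` kills the class. Conversely, if `d₂[[α]] = 0` with `∂α =
∂̄u`, then `∂u = ∂ζ + ∂̄v` with `∂̄ζ = 0` and `v` of bidegree `(n, n-2)`. As `∂v = 0` for degree
reasons, `α - (u - ζ) + v` is closed, and its `(n-2, n)` component is `α` (`range_edgeMap`).

Since bidegree is defined by scaling rather than by coordinates, the vanishing above the dimension
needs its own argument. Contraction with `u - i(iu)`, twice the `(1,0)` part of `u`, is complex
linear in `u` and lowers `p` by one. Each nonzero contraction strictly enlarges the kernel of the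
contraction map, and this kernel lies in an `n`-dimensional space, which bounds `p` by `n`
(`HasBidegree.eq_zero_of_finrank_ker`). Conjugation gives the bound on `q`. -/

namespace ComplexManifold

/-! ### Alternating maps of bidegree `(p, q)` vanish above the dimension. -/

section Alternating

variable {V : Type*} [AddCommGroup V] [Module ℂ V]

/-- The complex-linear part `u ↦ ι_u a - i ι_{iu} a` of the interior product with `a`. -/
noncomputable def linearContraction {m : ℕ} (a : V [⋀^Fin (m + 1)]→ₗ[ℝ] ℂ) :
    V →ₗ[ℂ] V [⋀^Fin m]→ₗ[ℝ] ℂ where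
  toFun u := a.curryLeft u - Complex.I • a.curryLeft (Complex.I • u)
  map_add' u w := by
    rw [smul_add, map_add, map_add, smul_add]
    abel
  map_smul' z u := by
    -- Interior products are only real linear in the vector, so `z` is split into real and imaginary
    -- parts. The combination with `i` is what turns this into multiplication by `z`.
    have hz : ∀ w : V, a.curryLeft (z • w) =
        z.re • a.curryLeft w + z.im • a.curryLeft (Complex.I • w) := by
      intro w
      conv_lhs => rw [← Complex.re_add_im z]
      rw [add_smul, mul_smul, Complex.coe_smul, Complex.coe_smul, map_add, map_smul, map_smul]
    rw [smul_comm Complex.I z u, hz, hz, smul_smul Complex.I Complex.I u, Complex.I_mul_I,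
      neg_one_smul, map_neg, RingHom.id_apply]
    ext v
    simp only [AlternatingMap.sub_apply, AlternatingMap.add_apply, AlternatingMap.smul_apply,
      AlternatingMap.neg_apply, Complex.real_smul, smul_eq_mul]
    generalize a.curryLeft u v = r
    generalize a.curryLeft (Complex.I • u) v = s
    conv_rhs => rw [← Complex.re_add_im z]
    ring_nf
    simp only [Complex.I_sq]
    ring

lemma linearContraction_apply {m : ℕ} (a : V [⋀^Fin (m + 1)]→ₗ[ℝ] ℂ) (u : V) (v : Fin m → V) :
    linearContraction a u v = a (Matrix.vecCons u v) -
      Complex.I * a (Matrix.vecCons (Complex.I • u) v) := rfl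

lemma cons_cons_swap {m : ℕ} (a : V [⋀^Fin (m + 2)]→ₗ[ℝ] ℂ) (u w : V) (v : Fin m → V) :
    a (Matrix.vecCons u (Matrix.vecCons w v)) = - a (Matrix.vecCons w (Matrix.vecCons u v)) := by
  rw [← a.map_swap _ (i := 0) (j := 1) (by simp)]
  congr 1
  funext i
  refine Fin.cases ?_ (fun i => ?_) i
  · simp
  · refine Fin.cases ?_ (fun i => ?_) i
    · simp
    · have h0 : (i.succ.succ : Fin (m + 2)) ≠ 0 := Fin.succ_ne_zero _
      have h1 : (i.succ.succ : Fin (m + 2)) ≠ 1 := by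
        rw [← Fin.succ_zero_eq_one, Ne, Fin.succ_inj]
        exact Fin.succ_ne_zero _
      simp [Equiv.swap_apply_of_ne_of_ne h0 h1]

/-- Each of the four terms of the double contraction changes sign when the first two arguments are
exchanged. -/
lemma linearContraction_comm {m : ℕ} (a : V [⋀^Fin (m + 2)]→ₗ[ℝ] ℂ) (u w : V) :
    linearContraction (linearContraction a u) w = - linearContraction (linearContraction a w) u := by
  ext v
  simp only [linearContraction_apply, AlternatingMap.neg_apply]
  rw [cons_cons_swap a u, cons_cons_swap a u, cons_cons_swap a (Complex.I • u),
    cons_cons_swap a (Complex.I • u)]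
  ring

lemma linearContraction_self {m : ℕ} (a : V [⋀^Fin (m + 2)]→ₗ[ℝ] ℂ) (u : V) :
    linearContraction (linearContraction a u) u = 0 :=
  AlternatingMap.ext fun v =>
    self_eq_neg.1 (congrArg (fun f => f v) (linearContraction_comm a u u))

/-- The alternating map `a` is multiplied by `z ^ p * conj z ^ q` when its arguments are
multiplied by `z`. -/
def HasBidegree {k : ℕ} (p q : ℕ) (a : V [⋀^Fin k]→ₗ[ℝ] ℂ) : Prop :=
  ∀ (z : ℂ) (v : Fin k → V), a (fun i => z • v i) = z ^ p * starRingEnd ℂ z ^ q * a v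

/-- Scaling `u` along with the other arguments produces the factor of bidegree `(p + 1, q)`. By
complex linearity in `u`, scaling `u` accounts for one factor `z`, which is then cancelled. -/
lemma HasBidegree.linearContraction {m p q : ℕ} {a : V [⋀^Fin (m + 1)]→ₗ[ℝ] ℂ}
    (ha : HasBidegree (p + 1) q a) (h : m = p + q) (u : V) :
    HasBidegree p q (linearContraction a u) := by
  intro z v
  -- The factor `z` cannot be cancelled at `z = 0`. There both sides are equal when no arguments
  -- remain, and both are zero otherwise.
  rcases eq_or_ne z 0 with rfl | hz
  · rcases Nat.eq_zero_or_pos m with rfl | hm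
    · obtain ⟨rfl, rfl⟩ : p = 0 ∧ q = 0 := by omega
      rw [pow_zero, pow_zero, one_mul, one_mul]
      congr 1
      exact Subsingleton.elim _ _
    · have h0 : (0 : ℂ) ^ p * starRingEnd ℂ 0 ^ q = 0 := by
        rw [map_zero, ← pow_add, ← h, zero_pow hm.ne']
      rw [h0, zero_mul]
      exact AlternatingMap.map_coord_zero _ ⟨0, hm⟩ (zero_smul _ _)
  · have h1 : ∀ w : V, a (Matrix.vecCons (z • w) (fun i => z • v i)) =
        z ^ (p + 1) * starRingEnd ℂ z ^ q * a (Matrix.vecCons w v) := by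
      intro w
      rw [← ha]
      congr 1
      funext i
      refine Fin.cases ?_ (fun i => ?_) i <;> simp
    have h2 : ComplexManifold.linearContraction a (z • u) (fun i => z • v i) =
        z ^ (p + 1) * starRingEnd ℂ z ^ q * ComplexManifold.linearContraction a u v := by
      rw [linearContraction_apply, smul_comm, h1, h1, linearContraction_apply]
      ring
    rw [map_smul, AlternatingMap.smul_apply, smul_eq_mul] at h2
    refine mul_left_cancel₀ hz (h2.trans ?_)
    ring

/-- Vanishing of the contraction says `a(iu, ...) = -i a(u, ...)`, which is conjugate linearity in
the first argument. A transposition carries it to the other arguments. -/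
lemma map_smul_of_linearContraction_eq_zero {m : ℕ} {a : V [⋀^Fin (m + 1)]→ₗ[ℝ] ℂ}
    (h : linearContraction a = 0) (j : Fin (m + 1)) (z : ℂ) (v : Fin (m + 1) → V) :
    a (Function.update v j (z • v j)) = starRingEnd ℂ z * a v := by
  have h0 : ∀ v : Fin (m + 1) → V,
      a (Function.update v 0 (z • v 0)) = starRingEnd ℂ z * a v := by
    intro v
    have hI : a (Matrix.vecCons (v 0) (Matrix.vecTail v)) -
        Complex.I * a (Matrix.vecCons (Complex.I • v 0) (Matrix.vecTail v)) = 0 := by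
      rw [← linearContraction_apply, h]
      rfl
    have e1 : Matrix.vecCons (v 0) (Matrix.vecTail v) = v := Matrix.cons_head_tail v
    have e2 : ∀ w, Matrix.vecCons w (Matrix.vecTail v) = Function.update v 0 w := by
      intro w
      funext i
      refine Fin.cases ?_ (fun i => ?_) i <;> simp [Matrix.vecTail]
    rw [e1, e2] at hI
    have hz : z • v 0 = z.re • v 0 + z.im • Complex.I • v 0 := by
      conv_lhs => rw [← Complex.re_add_im z]
      rw [add_smul, mul_smul, Complex.coe_smul, Complex.coe_smul]
    rw [hz, AlternatingMap.map_update_add, AlternatingMap.map_update_smul,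
      AlternatingMap.map_update_smul, Function.update_eq_self, Complex.real_smul,
      Complex.real_smul]
    have hc : starRingEnd ℂ z = z.re - z.im * Complex.I := by
      apply Complex.ext <;> simp
    rw [hc]
    linear_combination (z.im * Complex.I) * hI +
      z.im * a (Function.update v 0 (Complex.I • v 0)) * Complex.I_sq
  rcases eq_or_ne j 0 with rfl | hj
  · exact h0 v
  · have h1 := h0 (v ∘ Equiv.swap 0 j)
    have h2 : Function.update (v ∘ Equiv.swap 0 j) 0 (z • (v ∘ Equiv.swap 0 j) 0) =
        Function.update v j (z • v j) ∘ Equiv.swap 0 j := by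
      rw [Function.update_comp_equiv]
      simp
    rw [h2, a.map_swap _ hj.symm, a.map_swap _ hj.symm] at h1
    linear_combination -h1

lemma map_smul_univ_of_linearContraction_eq_zero {m : ℕ} {a : V [⋀^Fin (m + 1)]→ₗ[ℝ] ℂ}
    (h : linearContraction a = 0) (z : ℂ) (v : Fin (m + 1) → V) :
    a (fun i => z • v i) = starRingEnd ℂ z ^ (m + 1) * a v := by
  -- The arguments are scaled one at a time, each contributing a factor `conj z`.
  have key : ∀ s : Finset (Fin (m + 1)),
      a (fun i => if i ∈ s then z • v i else v i) = starRingEnd ℂ z ^ s.card * a v := by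
    intro s
    induction s using Finset.induction_on with
    | empty => simp
    | insert j s hj ih =>
      rw [Finset.card_insert_of_notMem hj, pow_succ', mul_assoc, ← ih,
        ← map_smul_of_linearContraction_eq_zero h j]
      congr 1
      funext i
      rcases eq_or_ne i j with rfl | hij
      · simp [hj]
      · simp [hij]
  simpa using key Finset.univ

/-- Such an `a` is conjugate linear in every argument, so it also has bidegree `(0, p + 1 + q)`. The
two scaling laws differ at a suitable `z`, which forces `a = 0`. -/
lemma eq_zero_of_linearContraction_eq_zero {m p q : ℕ} {a : V [⋀^Fin (m + 1)]→ₗ[ℝ] ℂ}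
    (ha : HasBidegree (p + 1) q a) (hm : m = p + q) (h : linearContraction a = 0) : a = 0 := by
  ext v
  -- On the unit circle the two scaling factors have quotient `z ^ (2 * (p + 1))`. This `z` makes
  -- the quotient `-1`.
  set z : ℂ := Complex.exp (Real.pi * Complex.I / (2 * (p + 1))) with hz
  have hp : (p : ℂ) + 1 ≠ 0 := by exact_mod_cast Nat.succ_ne_zero p
  have hz0 : z ≠ 0 := Complex.exp_ne_zero _
  have hconj : starRingEnd ℂ z = z⁻¹ := by
    rw [hz, ← Complex.exp_conj, ← Complex.exp_neg]
    congr 1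
    simp [Complex.conj_ofReal, Complex.conj_ofNat]
    ring
  have hpow : z ^ (p + 1) * z ^ (p + 1) = -1 := by
    rw [← pow_add, hz, ← Complex.exp_nat_mul, ← Complex.exp_pi_mul_I]
    congr 1
    push_cast
    field_simp
    ring
  have h1 := (ha z v).symm.trans (map_smul_univ_of_linearContraction_eq_zero h z v)
  have h2 : starRingEnd ℂ z ^ (m + 1) = starRingEnd ℂ z ^ (p + 1 + q) := by
    congr 1
    omega
  have h3 : z⁻¹ ^ (p + 1) * z ^ (p + 1) = 1 := by
    rw [← mul_pow, inv_mul_cancel₀ hz0, one_pow]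
  rw [h2, hconj, pow_add z⁻¹] at h1
  have h4 : z⁻¹ ^ q * z ^ q = 1 := by rw [← mul_pow, inv_mul_cancel₀ hz0, one_pow]
  -- Multiplying by `z ^ q * z ^ (p + 1)` clears the inverse powers, leaving `-a v` on the left and
  -- `a v` on the right.
  have h5 : z ^ q * z ^ (p + 1) * (z ^ (p + 1) * z⁻¹ ^ q * a v) =
      z ^ q * z ^ (p + 1) * (z⁻¹ ^ (p + 1) * z⁻¹ ^ q * a v) := by rw [h1]
  have h6 : -a v = a v := by
    linear_combination h5 - (z⁻¹ ^ q * z ^ q * a v) * hpow + (z⁻¹ ^ q * z ^ q * a v) * h3 +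
      2 * a v * h4
  exact neg_eq_self.1 h6

/-- The kernel dimension enters the hypothesis to make the induction on `p` close: contracting with
a vector outside the kernel lowers `p` by one and raises the kernel dimension by at least one, so
the inequality persists. When `p = 0` the inequality makes the kernel all of `V`. -/
lemma HasBidegree.eq_zero_of_finrank_ker [FiniteDimensional ℂ V] {p q m : ℕ} (hm : m = p + q)
    {a : V [⋀^Fin (m + 1)]→ₗ[ℝ] ℂ} (ha : HasBidegree (p + 1) q a)
    (h : Module.finrank ℂ V < Module.finrank ℂ (LinearMap.ker (ComplexManifold.linearContraction a))
      + (p + 1)) : a = 0 := by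
  induction p generalizing m with
  | zero =>
    refine eq_zero_of_linearContraction_eq_zero ha hm ?_
    rw [← LinearMap.ker_eq_top]
    refine Submodule.eq_top_of_finrank_eq (le_antisymm (Submodule.finrank_le _) (by omega))
  | succ p ih =>
    refine eq_zero_of_linearContraction_eq_zero ha hm (LinearMap.ext fun u => ?_)
    by_contra hu
    obtain ⟨m, rfl⟩ : ∃ l, m = l + 1 := ⟨p + q, by omega⟩
    refine hu (ih (by omega) (ha.linearContraction hm u) ?_)
    -- Anticommutation gives the inclusion. It is strict because `u` lies in the new kernel,
    -- contracting twice with `u` being zero, but not in the old one.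
    have hlt : LinearMap.ker (ComplexManifold.linearContraction a) <
        LinearMap.ker (ComplexManifold.linearContraction
          (ComplexManifold.linearContraction a u)) := by
      refine lt_of_le_of_ne (fun w hw => ?_) fun he => hu ?_
      · rw [LinearMap.mem_ker, linearContraction_comm, LinearMap.mem_ker.1 hw, neg_eq_zero]
        ext v
        simp [linearContraction_apply]
      · refine LinearMap.mem_ker.1 (he ▸ LinearMap.mem_ker.2 ?_)
        exact linearContraction_self a u
    have := Submodule.finrank_lt_finrank_of_lt hlt
    omega

lemma HasBidegree.eq_zero_of_finrank_lt [FiniteDimensional ℂ V] {p q k : ℕ} (hk : k = p + q)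
    {a : V [⋀^Fin k]→ₗ[ℝ] ℂ} (ha : HasBidegree p q a) (h : Module.finrank ℂ V < p) : a = 0 := by
  obtain ⟨p, rfl⟩ : ∃ l, p = l + 1 := ⟨p - 1, by omega⟩
  obtain ⟨m, rfl⟩ : ∃ l, k = l + 1 := ⟨p + q, by omega⟩
  exact ha.eq_zero_of_finrank_ker (by omega) (by omega)

lemma HasBidegree.conj {p q k : ℕ} {a : V [⋀^Fin k]→ₗ[ℝ] ℂ} (ha : HasBidegree p q a) :
    HasBidegree q p (Complex.conjAe.toLinearMap.compAlternatingMap a) := by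
  intro z v
  simp only [LinearMap.compAlternatingMap_apply, AlgEquiv.toLinearMap_apply, Complex.conjAe_coe]
  rw [ha z v]
  simp only [map_mul, map_pow, Complex.conj_conj]
  ring

/-- Complex conjugation of the values exchanges `p` and `q`. -/
lemma HasBidegree.eq_zero_of_finrank_lt' [FiniteDimensional ℂ V] {p q k : ℕ} (hk : k = p + q)
    {a : V [⋀^Fin k]→ₗ[ℝ] ℂ} (ha : HasBidegree p q a) (h : Module.finrank ℂ V < q) : a = 0 := by
  have h1 := ha.conj.eq_zero_of_finrank_lt (by omega) h
  ext v
  have h2 := congrArg (fun f => f v) h1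
  simpa using h2

end Alternating

/-! ### Bidegree components of forms on the manifold, and their behaviour under `∂`, `∂̄` and `d`.
-/

section Components

variable {E : Type*} [NormedAddCommGroup E] [NormedSpace ℂ E]
  {X : Type*} [TopologicalSpace X] [ChartedSpace E X]

lemma isOfType_eq_zero [FiniteDimensional ℂ E] {k p q : ℕ} (hk : p + q = k)
    (h : Module.finrank ℂ E < p ∨ Module.finrank ℂ E < q) {α : SmoothForm E X k}
    (hα : IsOfType p q α.1) : α = 0 := by
  refine SmoothForm.ext fun x v => ?_
  let a : E [⋀^Fin k]→ₗ[ℝ] ℂ := (show E [⋀^Fin k]→L[ℝ] ℂ from α.1 x).toAlternatingMap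
  have ha : HasBidegree p q a := fun z v => hα x z v
  have h0 : a = 0 := by
    rcases h with h | h
    · exact ha.eq_zero_of_finrank_lt hk.symm h
    · exact ha.eq_zero_of_finrank_lt' hk.symm h
  exact congrArg (fun f => f v) h0

lemma bidegreeForms_eq_zero [FiniteDimensional ℂ E] {p q : ℤ}
    (h : Module.finrank ℂ E < p ∨ Module.finrank ℂ E < q) {α : Forms E X}
    (hα : α ∈ bidegreeForms E X p q) : α = 0 := by
  funext k
  by_cases hk : 0 ≤ p ∧ 0 ≤ q ∧ p + q = k
  · exact isOfType_eq_zero (by omega) (by omega) ((hα k).1 hk)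
  · exact (hα k).2 hk

lemma bidegreeForms_le_homogeneousForms {p q k : ℤ} (h : p + q = k) :
    bidegreeForms E X p q ≤ homogeneousForms E X k :=
  fun _ hα j hj => (hα j).2 fun h' => hj (by omega)

lemma component_of_mem {p q : ℤ} {α : Forms E X} (hα : α ∈ bidegreeForms E X p q) :
    component E X p q α = α := by
  funext k
  rw [component, LinearMap.pi_apply]
  split_ifs with hk
  · exact (typeComp_of_type (by omega) (by omega) _ ((hα k).1 hk)).trans (if_pos rfl)
  · exact ((hα k).2 hk).symm

/-- Comparing first indices is enough: within one total degree they determine the bidegree, and in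
any other degree one of the two sides is zero by definition. -/
lemma component_of_mem_of_ne {p q r s : ℤ} (h : p ≠ r) {α : Forms E X}
    (hα : α ∈ bidegreeForms E X r s) : component E X p q α = 0 := by
  funext k
  rw [component, LinearMap.pi_apply]
  split_ifs with hk
  · by_cases hk' : 0 ≤ r ∧ 0 ≤ s ∧ r + s = k
    · exact (typeComp_of_type (by omega) (by omega) _ ((hα k).1 hk')).trans (if_neg (by omega))
    · rw [LinearMap.comp_apply, LinearMap.proj_apply, (hα k).2 hk', map_zero]
      rfl
  · rfl

variable [IsManifold 𝓘(ℂ, E) ω X]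

/-- By linearity it suffices to treat forms of pure type, where `∂` shifts the type by `(1, 0)`. The
case distinctions come from integer indices, which may be negative. -/
lemma component_del {p p' q : ℤ} (hp : p' = p + 1) (α : Forms E X) :
    component E X p' q (del E X α) = del E X (component E X p q α) := by
  subst hp
  funext k
  cases k with
  | zero =>
    rw [component, LinearMap.pi_apply]
    split_ifs
    · exact map_zero (typeComp E X 0 _ _)
    · rfl
  | succ j =>
    change _ = delDeg E X j (component E X p q α j)
    simp only [component, LinearMap.pi_apply]
    change (if 0 ≤ p + 1 ∧ 0 ≤ q ∧ p + 1 + q = ((j + 1 : ℕ) : ℤ) then _ else _ :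
      Forms E X →ₗ[ℂ] SmoothForm E X (j + 1)) (del E X α) = _
    split_ifs with h1 h2 h2
    · refine ext_of_type (typeComp E X (j + 1) (p + 1).toNat q.toNat ∘ₗ delDeg E X j)
        (delDeg E X j ∘ₗ typeComp E X j p.toNat q.toNat) (fun r s β h hβ => ?_) (α j)
      rw [LinearMap.comp_apply, LinearMap.comp_apply, typeComp_of_type (by omega) h β hβ,
        typeComp_of_type (by omega) (by omega) _ (delDeg_type h β hβ)]
      have : (p + 1).toNat = r + 1 ↔ p.toNat = r := by omega
      simp only [this]
      split_ifs <;> simp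
    -- This is the case `p = -1`. The right side is zero by definition, and the left side is zero
    -- because `∂` of a form of type `(r, s)` has first index `r + 1`, never `0`.
    · refine (ext_of_type (typeComp E X (j + 1) (p + 1).toNat q.toNat ∘ₗ delDeg E X j) 0
        (fun r s β h hβ => ?_) (α j)).trans (map_zero (delDeg E X j)).symm
      rw [LinearMap.comp_apply, typeComp_of_type (by omega) (by omega) _ (delDeg_type h β hβ),
        if_neg (by omega), LinearMap.zero_apply]
    · push_cast at h1
      omega
    · exact (map_zero (delDeg E X j)).symm

lemma component_delbar {p q q' : ℤ} (hq : q' = q + 1) (α : Forms E X) :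
    component E X p q' (delbar E X α) = delbar E X (component E X p q α) := by
  subst hq
  funext k
  cases k with
  | zero =>
    rw [component, LinearMap.pi_apply]
    split_ifs
    · exact map_zero (typeComp E X 0 _ _)
    · rfl
  | succ j =>
    change _ = delbarDeg E X j (component E X p q α j)
    simp only [component, LinearMap.pi_apply]
    change (if 0 ≤ p ∧ 0 ≤ q + 1 ∧ p + (q + 1) = ((j + 1 : ℕ) : ℤ) then _ else _ :
      Forms E X →ₗ[ℂ] SmoothForm E X (j + 1)) (delbar E X α) = _
    split_ifs with h1 h2 h2
    · refine ext_of_type (typeComp E X (j + 1) p.toNat (q + 1).toNat ∘ₗ delbarDeg E X j)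
        (delbarDeg E X j ∘ₗ typeComp E X j p.toNat q.toNat) (fun r s β h hβ => ?_) (α j)
      rw [LinearMap.comp_apply, LinearMap.comp_apply, typeComp_of_type (by omega) h β hβ,
        typeComp_of_type (by omega) (by omega) _ (delbarDeg_type h β hβ)]
      split_ifs <;> simp
    · refine (ext_of_type (typeComp E X (j + 1) p.toNat (q + 1).toNat ∘ₗ delbarDeg E X j) 0
        (fun r s β h hβ => ?_) (α j)).trans (map_zero (delbarDeg E X j)).symm
      rw [LinearMap.comp_apply, typeComp_of_type (by omega) (by omega) _ (delbarDeg_type h β hβ),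
        if_neg (by omega), LinearMap.zero_apply]
    · push_cast at h1
      omega
    · exact (map_zero (delbarDeg E X j)).symm

lemma component_d {p q p' q' : ℤ} (hp : p = p' + 1) (hq : q = q' + 1) (α : Forms E X) :
    component E X p q (d E X α) =
      del E X (component E X p' q α) + delbar E X (component E X p q' α) := by
  rw [← del_add_delbar, map_add, component_del hp, component_delbar hq]

/-! ### The edge map from de Rham cohomology to the second page, and its image. -/

variable [FiniteDimensional ℂ E]

/-- The component of bidegree `(p, dim X)` of a closed form defines a class on the second page. -/
lemma component_mem_e2Cycles {p q k : ℤ} (hq : q = Module.finrank ℂ E)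
    {α : Forms E X} (hα : α ∈ closedForms E X k) :
    component E X p q α ∈ e2Cycles E X p q := by
  have hα0 : d E X α = 0 := hα.2
  -- The witness comes from the `(p + 1, q)` component of `dα = 0`, which reads `∂α^{p,q} +
  -- ∂̄α^{p+1,q-1} = 0`.
  refine ⟨⟨component_mem E X p q α, ?_⟩, -component E X (p + 1) (q - 1) α,
    neg_mem (component_mem E X _ _ α), ?_⟩
  · exact bidegreeForms_eq_zero (Or.inr (by omega)) (delbar_mem rfl (component_mem E X p q α))
  · have h := component_d (p := p + 1) rfl (sub_add_cancel q 1).symm α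
    rw [hα0, map_zero] at h
    rw [map_neg, eq_neg_iff_add_eq_zero, h]

variable (E X) in
/-- The map sending a closed form to the second-page class of its component of bidegree
`(p, dim X)`. -/
noncomputable def closedFormsToE2 {p q : ℤ} (k : ℤ) (hq : q = Module.finrank ℂ E) :
    closedForms E X k →ₗ[ℂ] E2 E X p q :=
  E2.mk E X p q ∘ₗ LinearMap.codRestrict (e2Cycles E X p q)
    (component E X p q ∘ₗ (closedForms E X k).subtype) fun α => component_mem_e2Cycles hq α.2

/-- The identity `(dβ)^{p,q} = ∂β^{p-1,q} + ∂̄β^{p,q-1}` already has the shape required by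
`E2.mk_eq_zero`, since `β^{p-1,q}` is `∂̄`-closed when `q` is the dimension. -/
lemma exactForms_le_ker_closedFormsToE2 {p q : ℤ} (k : ℤ) (hq : q = Module.finrank ℂ E) :
    (exactForms E X k).submoduleOf (closedForms E X k) ≤
      LinearMap.ker (closedFormsToE2 E X (p := p) k hq) := by
  rintro ⟨_, hα⟩ ⟨β, -, rfl⟩
  refine LinearMap.mem_ker.2 ((E2.mk_eq_zero _).2 ⟨component E X (p - 1) q β,
    ⟨component_mem E X _ _ β, ?_⟩, component E X p (q - 1) β, component_mem E X _ _ β, ?_⟩)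
  · exact bidegreeForms_eq_zero (Or.inr (by omega)) (delbar_mem rfl (component_mem E X _ q β))
  · exact component_d (sub_add_cancel p 1).symm (sub_add_cancel q 1).symm β

variable (E X) in
/-- The edge map `{α} ↦ [[α^{p, dim X}]]` from de Rham cohomology to the second page. -/
noncomputable def edgeMap {p q : ℤ} (k : ℤ) (hq : q = Module.finrank ℂ E) :
    DeRham E X k →ₗ[ℂ] E2 E X p q :=
  Submodule.liftQ _ (closedFormsToE2 E X k hq) (exactForms_le_ker_closedFormsToE2 k hq)

/-- A closed form with prescribed `(p, q)` component is built by solving the components of `dβ = 0`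
successively. Only bidegrees `(p, q)`, `(p + 1, q - 1)` and `(p + 2, q - 2)` are needed, because `p
+ 2` is the dimension and the process then stops; `d₂` is thus the only obstruction. -/
lemma range_edgeMap {p q p' q' k : ℤ} (hq : q = Module.finrank ℂ E) (hpq : p + q = k)
    (hp' : p' = p + 2) (hq' : q' = q - 1) (hn : p' = Module.finrank ℂ E) :
    LinearMap.range (edgeMap E X (p := p) k hq) = LinearMap.ker (d2 E X hp' hq') := by
  subst hp' hq'
  apply le_antisymm
  · rintro _ ⟨y, rfl⟩
    obtain ⟨⟨α, hα⟩, rfl⟩ := Submodule.mkQ_surjective _ y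
    have hα0 : d E X α = 0 := hα.2
    rw [LinearMap.mem_ker]
    have h1 := component_d (p := p + 1) rfl (sub_add_cancel q 1).symm α
    have h2 := component_d (p := p + 2) (p' := p + 1) (by ring) (sub_add_cancel (q - 1) 1).symm α
    rw [hα0, map_zero] at h1 h2
    refine (d2_mk rfl rfl ⟨component E X p q α, component_mem_e2Cycles hq hα⟩
      (-component E X (p + 1) (q - 1) α) (neg_mem (component_mem E X _ _ α)) ?_).trans ?_
    · rw [map_neg, eq_neg_iff_add_eq_zero, h1]
    -- The `(p + 2, q - 1)` component of `dα = 0` gives `-∂α^{p+1,q-1} = ∂̄α^{p+2,q-2}`, so the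
    -- class is zero without any `∂` term.
    · refine (E2.mk_eq_zero _).2 ⟨0, zero_mem _, component E X (p + 2) (q - 1 - 1) α,
        component_mem E X _ _ α, ?_⟩
      change del E X (-component E X (p + 1) (q - 1) α) = _
      rw [map_neg, map_zero, zero_add, neg_eq_iff_add_eq_zero, h2]
  · intro y hy
    obtain ⟨⟨α, hα, u, hu, hau⟩, rfl⟩ := E2.mk_surjective E X p q y
    rw [LinearMap.mem_ker, d2_mk rfl rfl _ u hu hau] at hy
    obtain ⟨ζ, ⟨hζ, hζ0⟩, v, hv, huv⟩ := (E2.mk_eq_zero _).1 hy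
    change del E X u = _ at huv
    change del E X α = delbar E X u at hau
    have hα0 : delbar E X α = 0 := hα.2
    have hζ0' : delbar E X ζ = 0 := hζ0
    -- The first index of `∂v` is one more than the dimension.
    have hv0 : del E X v = 0 :=
      bidegreeForms_eq_zero (Or.inl (by omega)) (del_mem rfl hv)
    -- Replacing `u` by `u - ζ` keeps `∂α = ∂̄(u - ζ)` and gives `∂(u - ζ) = ∂̄v`. The alternating
    -- signs make these terms cancel in `d`.
    have hβ : α - (u - ζ) + v ∈ closedForms E X k := by
      refine ⟨add_mem (sub_mem (bidegreeForms_le_homogeneousForms hpq hα.1)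
        (sub_mem (bidegreeForms_le_homogeneousForms (by omega) hu)
          (bidegreeForms_le_homogeneousForms (by omega) hζ)))
        (bidegreeForms_le_homogeneousForms (by omega) hv), ?_⟩
      refine LinearMap.mem_ker.2 ?_
      rw [← del_add_delbar]
      simp only [map_add, map_sub, hα0, hζ0', hv0, hau, huv]
      abel
    refine ⟨DeRham.mk E X k ⟨_, hβ⟩, ?_⟩
    -- Equality holds already for representatives: `u`, `ζ` and `v` have first index larger than
    -- `p`, so they do not contribute to the `(p, q)` component.
    refine congrArg (E2.mk E X p q) (Subtype.ext ?_)
    change component E X p q (α - (u - ζ) + v) = α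
    rw [map_add, map_sub, map_sub, component_of_mem hα.1,
      component_of_mem_of_ne (by omega) hu, component_of_mem_of_ne (by omega) hζ,
      component_of_mem_of_ne (by omega) hv]
    abel

end Components

end ComplexManifold

theorem proposition3p1 (n : ℕ) (X : Type*) [TopologicalSpace X] [T2Space X] [CompactSpace X]
    [ChartedSpace (ComplexSpace n) X] [IsManifold 𝓘(ℂ, ComplexSpace n) ω X] :
    ∃ T : DeRham (ComplexSpace n) X (2 * (n : ℤ) - 2) →ₗ[ℂ] E2 (ComplexSpace n) X ((n : ℤ) - 2) n,
      (∀ α : closedForms (ComplexSpace n) X (2 * (n : ℤ) - 2),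
        ∃ hα : component (ComplexSpace n) X ((n : ℤ) - 2) n α.1 ∈
            e2Cycles (ComplexSpace n) X ((n : ℤ) - 2) n,
          T (DeRham.mk (ComplexSpace n) X (2 * (n : ℤ) - 2) α) =
            E2.mk (ComplexSpace n) X ((n : ℤ) - 2) n
              ⟨component (ComplexSpace n) X ((n : ℤ) - 2) n α.1, hα⟩) ∧
      LinearMap.range T =
        LinearMap.ker (d2 (ComplexSpace n) X (p := (n : ℤ) - 2) (q := n) (p' := n)
          (q' := (n : ℤ) - 1) (by ring) rfl) := by
  have hn : (n : ℤ) = Module.finrank ℂ (ComplexSpace n) := by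
    rw [finrank_euclideanSpace_fin]
  exact ⟨edgeMap (ComplexSpace n) X _ hn, fun α => ⟨component_mem_e2Cycles hn α.2, rfl⟩,
    range_edgeMap hn (by ring) _ _ hn⟩
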